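/- Let $(a_j)_{j\ge 1}$ be a strictly increasing sequence of non-zero real numbers with $\sum_{j\ge1} a_j^{-2}<\infty$. Write $a_j^{-2s}:=(a_j^2)^{-s}$ for $s\in\mathbb C$. Then for every $z\in\mathbb C$ the product $$p(z)=\prod_{j=1}^\infty\Bigl(1-\frac{z^2}{a_j^2}\Bigr)$$ converges, and $p$ is an entire function. Let $\log p$ be the holomorphic branch on $\mathbb C\setminus\{x\in\mathbb R:\ |x|\ge \min_j|a_j|\}$ with $\log p(0)=0$, that is $\log p(z)=\sum_j \operatorname{Log}(1-z^2/a_j^2)$ with the principal logarithm $\operatorname{Log}$ (this sum is holomorphic there and its exponential is $p$). Suppose in addition that there are $\kappa\in\mathbb N$ and $d,a,b,b_{-1},b_{-2}\in\mathbb R$ such that $$-\log p(z)=d\,w^{\kappa}+a\log w^2+b+\frac{b_{-1}}{w}+\frac{b_{-2}}{w^2}+O\Bigl(\frac1{w^3}\Bigr)\qquad(|z|\to\infty,\ z\notin\mathbb R),$$ where $w=-iz$ if $\operatorname{Im}z>0$ and $w=iz$ if $\operatorname{Im}z<0$ (so $|\arg w|<\pi/2$ and $z=\pm iw$), $\log w^2$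 is the principal value, and the $O$ is uniform on every closed subsector $|\arg w|\le\theta$, $\theta<\pi/2$. Then: 1. For every $s\in\mathbb C$ with $\operatorname{Re}(s)>\tfrac12$ the series $\zeta(s):=\sum_{j=1}^\infty a_j^{-2s}$ converges absolutely, and for every real $c$ with $0<c<\min_j|a_j|$ $$\zeta(s)=\frac{s^2}{\Gamma(s+1)}\int_0^\infty\frac{t^{s-1}}{2\pi i}\int_{\Lambda_c}\frac{2\,e^{-z^2t}}{z}\log p(z)\,dz\,dt,$$ where the inner integral (for every $t>0$) and the outer integral converge absolutely. Here $\Lambda_c=\{z\in\mathbb C:\ |\arg(z-c)|=\pi/8\}$ (together with its vertex $c$), oriented from $\infty e^{i\pi/8}$ through $c$ to $\infty e^{-i\pi/8}$. 2. $\zeta$ has a meromorphic continuation to a connected open set that contains $\{\operatorname{Re}(s)>\tfrac12\}$, $s=\tfrac12$ and $s=0$; it has a simple pole at $s=\tfrac12$ and no other singularity there. In particular $\zeta$ is holomorphic near $s=0$, and $$\zeta(0)=-a,\qquad \zeta'(0)=-b.$$ -/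

import Mathlib

noncomputable section

/-- The canonical product `p(z) = ∏ (1 - z² / a_j²)`. -/
def canonicalProduct (a : ℕ → ℝ) (z : ℂ) : ℂ :=
  ∏' j, (1 - z ^ 2 / (a j : ℂ) ^ 2)

/-- The plane with the two real half-lines that carry the zeros of the product removed. -/
def slitDomain (a : ℕ → ℝ) : Set ℂ :=
  {z | ∀ j, ¬ (z.im = 0 ∧ |a j| ≤ |z.re|)}

/-- The logarithm of the product that vanishes at `0`: the sum of the principal logarithms of
the factors. For `z` in `slitDomain a` no factor lies on the cut `(-∞, 0]`. -/
def logProduct (a : ℕ → ℝ) (z : ℂ) : ℂ :=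
  ∑' j, Complex.log (1 - z ^ 2 / (a j : ℂ) ^ 2)

/-- The asymptotic expansion
`-log p(iw) = d w^κ + A log w² + B + b₁ / w + b₂ / w² + O(w⁻³)` in the sector `|arg w| < π / 2`,
uniformly on every closed subsector. As `p` is even, `z = iw` and `z = -iw` cover the points off
the real axis, both with the same expansion. -/
def HasLogExpansion (a : ℕ → ℝ) (κ : ℕ) (d A B b₁ b₂ : ℝ) : Prop :=
  ∀ θ : ℝ, 0 < θ → θ < Real.pi / 2 → ∃ C R : ℝ, 0 < R ∧
    ∀ w : ℂ, |w.arg| ≤ θ → R ≤ ‖w‖ →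
      ‖-logProduct a (Complex.I * w) -
        ((d : ℂ) * w ^ κ + (A : ℂ) * Complex.log (w ^ 2) + (B : ℂ) + (b₁ : ℂ) / w
          + (b₂ : ℂ) / w ^ 2)‖ ≤ C / ‖w‖ ^ 3

/-- The term `a_j^{-2s}`, that is `(a_j²)^{-s}`, of the zeta series. -/
def zetaTerm (a : ℕ → ℝ) (s : ℂ) (j : ℕ) : ℂ :=
  1 / (((a j) ^ 2 : ℝ) : ℂ) ^ s

/-- The zeta series `∑ a_j^{-2s}`. -/
def zetaSeries (a : ℕ → ℝ) (s : ℂ) : ℂ :=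
  ∑' j, zetaTerm a s j

/-- The pull-back of `f(z) dz` to the half-line from `c` with direction `exp(iφ)`. -/
def rayIntegrand (f : ℂ → ℂ) (c φ : ℝ) (r : ℝ) : ℂ :=
  f ((c : ℂ) + (r : ℂ) * Complex.exp ((φ : ℂ) * Complex.I)) * Complex.exp ((φ : ℂ) * Complex.I)

/-- Absolute convergence of the integral of `f` over `Λ_c = {z | |arg (z - c)| = π / 8}`. -/
def WedgeIntegrable (f : ℂ → ℂ) (c : ℝ) : Prop :=
  MeasureTheory.IntegrableOn (rayIntegrand f c (Real.pi / 8)) (Set.Ioi 0) ∧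
  MeasureTheory.IntegrableOn (rayIntegrand f c (-(Real.pi / 8))) (Set.Ioi 0)

/-- The integral of `f` over `Λ_c = {z | |arg (z - c)| = π / 8}`, which comes in from infinity
along the upper half-line to `c` and leaves along the lower one (so that the half-line `(c, ∞)`
lies on its left). -/
def wedgeIntegral (f : ℂ → ℂ) (c : ℝ) : ℂ :=
  (∫ r in Set.Ioi (0 : ℝ), rayIntegrand f c (-(Real.pi / 8)) r) -
    ∫ r in Set.Ioi (0 : ℝ), rayIntegrand f c (Real.pi / 8) r

/-- The integrand `2 exp(-z² t) / z * log p(z)` of the inner integral. -/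
def innerIntegrand (a : ℕ → ℝ) (t : ℝ) (z : ℂ) : ℂ :=
  2 * Complex.exp (-(z ^ 2 * (t : ℂ))) / z * logProduct a z

/-- The integrand `t^(s-1) / (2πi) ∫_{Λ_c} 2 exp(-z² t) / z * log p(z) dz` of the outer
integral. -/
def outerIntegrand (a : ℕ → ℝ) (c : ℝ) (s : ℂ) (t : ℝ) : ℂ :=
  (t : ℂ) ^ (s - 1) / (2 * (Real.pi : ℂ) * Complex.I) * wedgeIntegral (innerIntegrand a t) c

end

/-! Two Mellin transforms carry the proof. For the integral representation put u = z², so that 2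
dz/z = du/u. Since exp(-tu)/u is minus the derivative of E₁(tu), integration by parts turns the
wedge integral of one factor into that of E₁(tu)/(u - a_j²). All that survives is the jump of the
logarithm across [a_j², ∞), and the value is 2πi E₁(a_j² t) (`wedgeIntegral_wedgeTerm`). Summation
over j gives `wedgeIntegral_innerIntegrand`. As E₁ has Mellin transform Γ(s)/s and the dilation by
a_j² contributes a_j^(-2s), `zeta_integral_representation` follows.

For the continuation only L(y) = log p(iy) = ∑ log(1 + y²/a_j²) is needed. It is nonnegative, o(y²),
and outgrows every multiple of log y, so the expansion forces κ = 1 and d ≠ 0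
(`HasLogExpansion.eq_one_and_ne_zero`). Linear growth of L makes a_j grow at least linearly, whence
convergence for Re s > 1/2. With y = t^(-1/2), the Mellin transform of L in t is ζ(s)Γ(s)Γ(1-s)/s on
1/2 < Re s < 1. Adding d t^(-1/2) - A log t + B on (0, 1] leaves O(t^(1/2)) at 0 and O(1/t) at
infinity, hence a transform M(s) holomorphic on -1/2 < Re s < 1; the added part has transform d/(s -
1/2) + A/s² + B/s. Solving, ζ(s) = s²/(Γ(1+s)Γ(1-s)) · (M(s) - d/(s - 1/2) - A/s² - B/s). The term
with d gives the pole, and as 1/(Γ(1+s)Γ(1-s)) is even with value 1 at 0, ζ(s) = -A - Bs + O(s²). -/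

section Auxiliary

open MeasureTheory Set Filter Topology Asymptotics

/-! ### The canonical product and its logarithm. -/

section Product

variable {a : ℕ → ℝ}

theorem norm_sq_div_ofReal_sq (z : ℂ) (x : ℝ) :
    ‖z ^ 2 / (x : ℂ) ^ 2‖ = ‖z‖ ^ 2 * (1 / x ^ 2) := by
  rw [norm_div, norm_pow, norm_pow, Complex.norm_real, Real.norm_eq_abs, sq_abs]
  ring

theorem summable_norm_sq_div (hsum : Summable fun j => 1 / (a j) ^ 2) (z : ℂ) :
    Summable fun j => ‖z ^ 2 / (a j : ℂ) ^ 2‖ := by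
  simpa only [norm_sq_div_ofReal_sq] using hsum.mul_left (‖z‖ ^ 2)

theorem multipliable_one_sub_sq_div (hsum : Summable fun j => 1 / (a j) ^ 2) (z : ℂ) :
    Multipliable fun j => 1 - z ^ 2 / (a j : ℂ) ^ 2 := by
  simp only [sub_eq_add_neg]
  refine multipliable_one_add_of_summable ?_
  simpa only [norm_neg] using summable_norm_sq_div hsum z

theorem summable_log_one_sub_sq_div (hsum : Summable fun j => 1 / (a j) ^ 2) (z : ℂ) :
    Summable fun j => Complex.log (1 - z ^ 2 / (a j : ℂ) ^ 2) := by
  simp only [sub_eq_add_neg]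
  exact Complex.summable_log_one_add_of_summable (summable_norm_sq_div hsum z).of_norm.neg

theorem differentiable_canonicalProduct (hsum : Summable fun j => 1 / (a j) ^ 2) :
    Differentiable ℂ (canonicalProduct a) := by
  intro z₀
  have hopen : IsOpen (Metric.ball (0 : ℂ) (‖z₀‖ + 1)) := Metric.isOpen_ball
  have hz₀ : z₀ ∈ Metric.ball (0 : ℂ) (‖z₀‖ + 1) := by simp
  have h := Summable.hasProdLocallyUniformlyOn_nat_one_add (R := ℂ)
    (f := fun j (z : ℂ) => -(z ^ 2 / (a j : ℂ) ^ 2)) hopen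
    (hsum.mul_left ((‖z₀‖ + 1) ^ 2))
    (Eventually.of_forall fun j z hz => by
      rw [norm_neg, norm_sq_div_ofReal_sq]
      have : ‖z‖ < ‖z₀‖ + 1 := by simpa using hz
      gcongr)
    (fun j => by fun_prop)
  have h2 := h.differentiableOn
    (.of_forall fun _ ↦ by
      simpa [Finset.prod_fn] using DifferentiableOn.finsetProd (fun _ _ ↦ by fun_prop)) hopen
  have h3 := (h2 z₀ hz₀).differentiableAt (hopen.mem_nhds hz₀)
  simp only [← sub_eq_add_neg] at h3
  exact h3

theorem one_sub_sq_div_mem_slitPlane (ha0 : ∀ j, a j ≠ 0) {z : ℂ} (hz : z ∈ slitDomain a) (j : ℕ) :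
    1 - z ^ 2 / (a j : ℂ) ^ 2 ∈ Complex.slitPlane := by
  by_contra hcon
  have ha2 : 0 < a j ^ 2 := by have := ha0 j; positivity
  have hre : (z ^ 2 / (a j : ℂ) ^ 2).re = (z.re ^ 2 - z.im ^ 2) / a j ^ 2 := by
    rw [← Complex.ofReal_pow, Complex.div_ofReal_re]; simp [pow_two]
  have him : (z ^ 2 / (a j : ℂ) ^ 2).im = (2 * z.re * z.im) / a j ^ 2 := by
    rw [← Complex.ofReal_pow, Complex.div_ofReal_im]; simp [pow_two]; ring
  rw [Complex.mem_slitPlane_iff, not_or, not_lt, not_not] at hcon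
  obtain ⟨h1, h2⟩ := hcon
  rw [Complex.sub_re, hre, Complex.one_re, sub_nonpos, le_div_iff₀ ha2] at h1
  rw [Complex.sub_im, him, Complex.one_im, zero_sub, neg_eq_zero, div_eq_zero_iff] at h2
  have h3 : z.re * z.im = 0 := by
    rcases h2 with h2 | h2
    · linarith
    · exact absurd h2 ha2.ne'
  have h4 : z.im = 0 := by
    rcases mul_eq_zero.mp h3 with h | h
    · rw [h] at h1; nlinarith [sq_nonneg z.im]
    · exact h
  refine hz j ⟨h4, ?_⟩
  rw [h4] at h1
  exact sq_le_sq.mp (by linarith)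

/-- On a disc around 0 containing z₀ all but finitely many factors lie within 1/2 of 1, so the tail
is a normally convergent series of holomorphic functions; the slit domain matters only for the
finitely many others. -/
theorem differentiableAt_logProduct (ha0 : ∀ j, a j ≠ 0)
    (hsum : Summable fun j => 1 / (a j) ^ 2) {z₀ : ℂ} (hz₀ : z₀ ∈ slitDomain a) :
    DifferentiableAt ℂ (logProduct a) z₀ := by
  set R := ‖z₀‖ + 1 with hR
  obtain ⟨N, hN⟩ : ∃ N, ∀ j ≥ N, R ^ 2 * (1 / a j ^ 2) < 1 / 2 := by
    have h0 := (hsum.mul_left (R ^ 2)).tendsto_atTop_zero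
    exact eventually_atTop.mp (h0.eventually_lt_const (by norm_num))
  have hmem : z₀ ∈ Metric.ball (0 : ℂ) R := by simp [hR]
  have hbd : ∀ j, ∀ z ∈ Metric.ball (0 : ℂ) R,
      ‖-(z ^ 2 / (a (j + N) : ℂ) ^ 2)‖ ≤ R ^ 2 * (1 / a (j + N) ^ 2) := by
    intro j z hz
    rw [norm_neg, norm_sq_div_ofReal_sq]
    have : ‖z‖ < R := by simpa using hz
    gcongr
  have htail : DifferentiableOn ℂ
      (fun z => ∑' j, Complex.log (1 - z ^ 2 / (a (j + N) : ℂ) ^ 2)) (Metric.ball 0 R) := by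
    refine Complex.differentiableOn_tsum_of_summable_norm
      (u := fun j => 3 / 2 * (R ^ 2 * (1 / a (j + N) ^ 2)))
      ((((summable_nat_add_iff N).mpr hsum).mul_left _).mul_left _) (fun j => ?_)
      Metric.isOpen_ball (fun j z hz => ?_)
    · intro z hz
      refine (DifferentiableAt.clog (by fun_prop) ?_).differentiableWithinAt
      refine Complex.mem_slitPlane_iff.mpr (Or.inl ?_)
      have h1 := (hbd j z hz).trans (hN (j + N) (Nat.le_add_left _ _)).le
      have h2 := (Complex.abs_re_le_norm _).trans h1
      rw [sub_eq_add_neg, Complex.add_re, Complex.one_re]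
      linarith [(abs_le.mp h2).1]
    · have h1 := (hbd j z hz).trans (hN (j + N) (Nat.le_add_left _ _)).le
      rw [sub_eq_add_neg]
      refine (Complex.norm_log_one_add_half_le_self h1).trans ?_
      gcongr
      exact hbd j z hz
  have heq : logProduct a = fun z =>
      (∑ j ∈ Finset.range N, Complex.log (1 - z ^ 2 / (a j : ℂ) ^ 2)) +
        ∑' j, Complex.log (1 - z ^ 2 / (a (j + N) : ℂ) ^ 2) := by
    funext z
    exact ((summable_log_one_sub_sq_div hsum z).sum_add_tsum_nat_add N).symm
  rw [heq]
  refine DifferentiableAt.add ?_ ((htail z₀ hmem).differentiableAt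
    (Metric.isOpen_ball.mem_nhds hmem))
  refine DifferentiableAt.fun_sum fun j _ => ?_
  exact DifferentiableAt.clog (by fun_prop) (one_sub_sq_div_mem_slitPlane ha0 hz₀ j)

theorem exp_logProduct (ha0 : ∀ j, a j ≠ 0) (hsum : Summable fun j => 1 / (a j) ^ 2) {z : ℂ}
    (hz : z ∈ slitDomain a) : Complex.exp (logProduct a z) = canonicalProduct a z :=
  Complex.cexp_tsum_eq_tprod
    (fun j => Complex.slitPlane_ne_zero (one_sub_sq_div_mem_slitPlane ha0 hz j))
    (summable_log_one_sub_sq_div hsum z)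

end Product

/-! ### Mellin transforms of superpositions of dilates. -/

section Mellin

theorem norm_cpow_smul_of_pos {t : ℝ} (ht : 0 < t) (s x : ℂ) :
    ‖(t : ℂ) ^ (s - 1) • x‖ = t ^ (s.re - 1) * ‖x‖ := by
  rw [norm_smul, Complex.norm_cpow_eq_rpow_re_of_pos ht, Complex.sub_re, Complex.one_re]

theorem integral_norm_cpow_smul_comp_mul (f : ℝ → ℂ) (s : ℂ) {c : ℝ} (hc : 0 < c) :
    ∫ t in Ioi (0 : ℝ), ‖(t : ℂ) ^ (s - 1) • f (c * t)‖ =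
      c ^ (-s.re) * ∫ t in Ioi (0 : ℝ), ‖(t : ℂ) ^ (s - 1) • f t‖ := by
  have h1 : ∀ t ∈ Ioi (0 : ℝ), ‖(t : ℂ) ^ (s - 1) • f (c * t)‖ =
      c ^ (1 - s.re) * (fun u : ℝ => ‖(u : ℂ) ^ (s - 1) • f u‖) (c * t) := by
    intro t ht
    have ht : 0 < t := ht
    simp only
    rw [norm_cpow_smul_of_pos ht, norm_cpow_smul_of_pos (mul_pos hc ht),
      Real.mul_rpow hc.le ht.le, ← mul_assoc, ← mul_assoc, ← Real.rpow_add hc]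
    simp
  rw [setIntegral_congr_fun measurableSet_Ioi h1, integral_const_mul,
    integral_comp_mul_left_Ioi (fun u : ℝ => ‖(u : ℂ) ^ (s - 1) • f u‖) 0 hc, mul_zero, smul_eq_mul,
    ← mul_assoc]
  congr 1
  rw [← Real.rpow_neg_one, ← Real.rpow_add hc]
  congr 1
  ring

/-- The Mellin transform of a superposition of dilates of `f`. -/
theorem hasMellin_integral_comp_mul {α : Type*} [MeasurableSpace α] {μ : Measure α} [SFinite μ]
    {f : ℝ → ℂ} (hf : Measurable f) {s : ℂ} (hfs : MellinConvergent f s)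
    {φ : α → ℝ} (hφ : Measurable φ) (hpos : ∀ᵐ x ∂μ, 0 < φ x) {k : α → ℂ} (hk : Measurable k)
    (hint : Integrable (fun x => k x * (φ x : ℂ) ^ (-s)) μ) :
    HasMellin (fun t => ∫ x, k x * f (φ x * t) ∂μ) s
      ((∫ x, k x * (φ x : ℂ) ^ (-s) ∂μ) * mellin f s) := by
  -- By scaling, the t-integral of the norm at x is |k(x) φ(x)^(-s)| times a constant, so `hint` is
  -- what Fubini requires.
  have hprod : Integrable (Function.uncurry
      fun (x : α) (t : ℝ) => (t : ℂ) ^ (s - 1) • (k x * f (φ x * t)))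
      (μ.prod (volume.restrict (Ioi 0))) := by
    refine (integrable_prod_iff ?_).mpr ⟨?_, ?_⟩
    · refine Measurable.aestronglyMeasurable ?_
      simp only [Function.uncurry_def, smul_eq_mul]
      fun_prop
    · filter_upwards [hpos] with x hx
      have := ((MellinConvergent.comp_mul_left (s := s) hx).mpr hfs).const_smul (k x)
      simpa only [Function.uncurry, smul_eq_mul] using! this
    · have h2 : ∀ᵐ x ∂μ, ∫ t, ‖(Function.uncurry
          fun (x : α) (t : ℝ) => (t : ℂ) ^ (s - 1) • (k x * f (φ x * t))) (x, t)‖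
            ∂(volume.restrict (Ioi 0)) =
          ‖k x * (φ x : ℂ) ^ (-s)‖ * ∫ t in Ioi (0 : ℝ), ‖(t : ℂ) ^ (s - 1) • f t‖ := by
        filter_upwards [hpos] with x hx
        have h3 : ∀ t : ℝ, ‖(t : ℂ) ^ (s - 1) • (k x * f (φ x * t))‖ =
            ‖k x‖ * ‖(t : ℂ) ^ (s - 1) • f (φ x * t)‖ := by
          intro t; rw [norm_smul, norm_smul, norm_mul]; ring
        simp only [Function.uncurry, h3]
        rw [integral_const_mul, integral_norm_cpow_smul_comp_mul f s hx, norm_mul,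
          Complex.norm_cpow_eq_rpow_re_of_pos hx, Complex.neg_re]
        ring
      exact (hint.norm.mul_const _).congr (h2.mono fun x hx => hx.symm)
  have hswap : ∀ t : ℝ, (t : ℂ) ^ (s - 1) • ∫ x, k x * f (φ x * t) ∂μ =
      ∫ x, (t : ℂ) ^ (s - 1) • (k x * f (φ x * t)) ∂μ := fun t => (integral_smul _ _).symm
  refine ⟨?_, ?_⟩
  · simp only [MellinConvergent, hswap]
    exact hprod.integral_prod_right
  · simp only [mellin, hswap]
    rw [← integral_integral_swap hprod, ← integral_mul_const]
    refine integral_congr_ae ?_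
    filter_upwards [hpos] with x hx
    have h4 := mellin_comp_mul_left f s hx
    simp only [mellin] at h4
    rw [mul_assoc, ← smul_eq_mul (a := (φ x : ℂ) ^ (-s)), ← h4, ← smul_eq_mul (a := k x),
      ← integral_smul]
    refine integral_congr_ae (Eventually.of_forall fun t => ?_)
    simp only [smul_eq_mul]
    ring

/-- Lets series be treated as integrals against counting measure. Without summability both sides
take the default value 0. -/
theorem integral_count_nat (g : ℕ → ℂ) : ∫ j, g j ∂Measure.count = ∑' j, g j := by
  by_cases h : Integrable g Measure.count
  · rw [integral_countable h]
    simp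
  · rw [integral_undef h, tsum_eq_zero_of_not_summable]
    rwa [integrable_count_iff, summable_norm_iff] at h

theorem hasMellin_tsum_comp_mul {f : ℝ → ℂ} (hf : Measurable f) {s : ℂ}
    (hfs : MellinConvergent f s) {b : ℕ → ℝ} (hb : ∀ j, 0 < b j)
    (hsum : Summable fun j => (b j : ℂ) ^ (-s)) :
    HasMellin (fun t => ∑' j, f (b j * t)) s ((∑' j, (b j : ℂ) ^ (-s)) * mellin f s) := by
  have h := hasMellin_integral_comp_mul (μ := (Measure.count : Measure ℕ)) hf hfs
    (φ := b) measurable_from_nat (Eventually.of_forall hb) (k := fun _ => 1) measurable_const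
    (by simpa [integrable_count_iff] using hsum.norm)
  simpa only [one_mul, integral_count_nat] using h

/-- The Mellin transform of `t ↦ ∫₁^∞ f(tv)/v dv`. -/
theorem hasMellin_integral_Ioi_one {f : ℝ → ℂ} (hf : Measurable f) {s : ℂ} (hs : 0 < s.re)
    (hfs : MellinConvergent f s) :
    HasMellin (fun t => ∫ v in Ioi (1 : ℝ), (v : ℂ)⁻¹ * f (v * t)) s (mellin f s / s) := by
  have hs0 : s ≠ 0 := by rintro rfl; simp at hs
  have h1 : ∀ v ∈ Ioi (1 : ℝ), (v : ℂ)⁻¹ * ((id v : ℝ) : ℂ) ^ (-s) = (v : ℂ) ^ (-1 - s) := by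
    intro v hv
    have hv : (v : ℂ) ≠ 0 := by
      have : (0 : ℝ) < v := lt_trans one_pos hv
      exact_mod_cast this.ne'
    rw [id, sub_eq_add_neg, Complex.cpow_add _ _ hv, Complex.cpow_neg_one]
  have hlt : (-1 - s).re < -1 := by simp; exact hs
  have h := hasMellin_integral_comp_mul (μ := volume.restrict (Ioi (1 : ℝ))) hf hfs
    (φ := id) measurable_id
    (by
      filter_upwards [ae_restrict_mem measurableSet_Ioi] with v hv
      exact lt_trans one_pos hv) (k := fun v => (v : ℂ)⁻¹) (by fun_prop)
    ((integrableOn_Ioi_cpow_of_lt hlt one_pos).congr_fun (fun v hv => (h1 v hv).symm)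
      measurableSet_Ioi)
  rw [setIntegral_congr_fun measurableSet_Ioi h1, integral_Ioi_cpow_of_lt hlt one_pos] at h
  rw [show (-1 - s + 1 : ℂ) = -s by ring] at h
  have h3 : -((1 : ℝ) : ℂ) ^ (-s) / (-s) * mellin f s = mellin f s / s := by
    simp
    field_simp
  rwa [h3] at h

end Mellin

/-! ### Mellin transforms of exp(-t), E₁(t), 1/(1+t) and log(1+1/t). -/

section SpecialMellin

theorem HasMellin.congr {f g : ℝ → ℂ} {s m : ℂ} (h : HasMellin f s m)
    (hfg : ∀ t, 0 < t → f t = g t) : HasMellin g s m := by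
  have heq : ∀ t ∈ Ioi (0 : ℝ), (t : ℂ) ^ (s - 1) • f t = (t : ℂ) ^ (s - 1) • g t :=
    fun t ht => by rw [hfg t ht]
  refine ⟨IntegrableOn.congr_fun h.1 heq measurableSet_Ioi, ?_⟩
  rw [← h.2]
  exact (setIntegral_congr_fun measurableSet_Ioi heq).symm

theorem hasMellin_exp_neg {s : ℂ} (hs : 0 < s.re) :
    HasMellin (fun t : ℝ => Complex.exp (-(t : ℂ))) s (Complex.Gamma s) := by
  have heq : (fun t : ℝ => ((Real.exp (-t) : ℝ) : ℂ) * (t : ℂ) ^ (s - 1)) =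
      fun t : ℝ => (t : ℂ) ^ (s - 1) • Complex.exp (-(t : ℂ)) := by
    funext t
    rw [smul_eq_mul, mul_comm, Complex.ofReal_exp, Complex.ofReal_neg]
  refine ⟨?_, ?_⟩
  · have := Complex.GammaIntegral_convergent hs
    rwa [heq] at this
  · rw [Complex.Gamma_eq_integral hs, Complex.GammaIntegral, heq]
    rfl

/-- The exponential integral `E₁(w) = ∫₁^∞ exp(-vw)/v dv`. -/
noncomputable def expInt (w : ℂ) : ℂ :=
  ∫ v in Ioi (1 : ℝ), (v : ℂ)⁻¹ * Complex.exp (-((v : ℂ) * w))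

theorem hasMellin_expInt {s : ℂ} (hs : 0 < s.re) :
    HasMellin (fun t : ℝ => expInt t) s (Complex.Gamma s / s) := by
  have h := hasMellin_integral_Ioi_one (f := fun t : ℝ => Complex.exp (-(t : ℂ))) (by fun_prop) hs
    (hasMellin_exp_neg hs).1
  rw [(hasMellin_exp_neg hs).2] at h
  simp only [Complex.ofReal_mul] at h
  exact h

/-- 1/(1+t) = ∫₀^∞ exp(-x) exp(-xt) dx superposes dilates of the exponential, and the weight exp(-x)
has x^(-s)-moment Γ(1-s). -/
theorem hasMellin_one_div_one_add {s : ℂ} (hs : 0 < s.re) (hs1 : s.re < 1) :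
    HasMellin (fun t : ℝ => 1 / (1 + (t : ℂ))) s (Complex.Gamma (1 - s) * Complex.Gamma s) := by
  have hs2 : 0 < (1 - s).re := by simpa using hs1
  have h1 := hasMellin_exp_neg hs2
  have he : (1 : ℂ) - s - 1 = -s := by ring
  have h2 := hasMellin_integral_comp_mul (μ := volume.restrict (Ioi (0 : ℝ)))
    (f := fun t : ℝ => Complex.exp (-(t : ℂ))) (by fun_prop) (hasMellin_exp_neg hs).1
    (φ := id) measurable_id (ae_restrict_mem measurableSet_Ioi)
    (k := fun x : ℝ => Complex.exp (-(x : ℂ))) (by fun_prop)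
    (by
      have := h1.1
      simp only [MellinConvergent, he, smul_eq_mul] at this
      simpa only [mul_comm, id] using! this)
  have h3 : ∫ x in Ioi (0 : ℝ), Complex.exp (-(x : ℂ)) * ((id x : ℝ) : ℂ) ^ (-s) =
      Complex.Gamma (1 - s) := by
    rw [← h1.2, mellin]
    simp only [he, smul_eq_mul, id, mul_comm]
  rw [h3, (hasMellin_exp_neg hs).2] at h2
  refine h2.congr fun t ht => ?_
  have h4 : ∀ x : ℝ, Complex.exp (-(x : ℂ)) * Complex.exp (-((id x * t : ℝ) : ℂ)) =
      Complex.exp (-(1 + (t : ℂ)) * x) := by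
    intro x
    rw [← Complex.exp_add]
    congr 1
    simp
    ring
  simp only [h4]
  rw [integral_exp_mul_complex_Ioi (by simp; linarith)]
  simp only [Complex.ofReal_zero, mul_zero, Complex.exp_zero, neg_div_neg_eq]

theorem integral_Ioi_one_inv_mul_one_add {t : ℝ} (ht : 0 < t) :
    ∫ v in Ioi (1 : ℝ), v⁻¹ * (1 / (1 + v * t)) = Real.log (1 + 1 / t) := by
  -- The primitive log v - log(1 + vt), written so that its limit at infinity is visible.
  have hlim : Tendsto (fun v : ℝ => -Real.log (v⁻¹ + t)) atTop (𝓝 (-Real.log t)) := by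
    have h1 : Tendsto (fun v : ℝ => v⁻¹ + t) atTop (𝓝 (0 + t)) :=
      tendsto_inv_atTop_zero.add_const t
    rw [zero_add] at h1
    exact (h1.log ht.ne').neg
  have hd : ∀ v ∈ Ici (1 : ℝ), HasDerivAt (fun v : ℝ => -Real.log (v⁻¹ + t))
      (v⁻¹ * (1 / (1 + v * t))) v := by
    intro v hv
    have hv : 0 < v := lt_of_lt_of_le one_pos hv
    have h1 : v⁻¹ + t ≠ 0 := by positivity
    have h2 : 1 + v * t ≠ 0 := by positivity
    have h3 : v⁻¹ * (1 / (1 + v * t)) = -(-(v ^ 2)⁻¹ / (v⁻¹ + t)) := by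
      have h4 : v⁻¹ + t = (1 + v * t) / v := by field_simp
      rw [h4]
      field_simp
    rw [h3]
    exact (((hasDerivAt_inv hv.ne').add_const t).log h1).neg
  rw [integral_Ioi_of_hasDerivAt_of_nonneg' hd (fun v hv => by
    have hv : 0 < v := lt_trans one_pos hv
    positivity) hlim]
  have : 1 + 1 / t = (1⁻¹ + t) / t := by field_simp; ring
  rw [this, Real.log_div (by positivity) ht.ne']
  ring

theorem hasMellin_log_one_add_inv {s : ℂ} (hs : 0 < s.re) (hs1 : s.re < 1) :
    HasMellin (fun t : ℝ => ((Real.log (1 + 1 / t) : ℝ) : ℂ)) s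
      (Complex.Gamma (1 - s) * Complex.Gamma s / s) := by
  have h := hasMellin_integral_Ioi_one (f := fun t : ℝ => 1 / (1 + (t : ℂ))) (by fun_prop) hs
    (hasMellin_one_div_one_add hs hs1).1
  rw [(hasMellin_one_div_one_add hs hs1).2] at h
  refine h.congr fun t ht => ?_
  rw [← integral_Ioi_one_inv_mul_one_add ht, ← integral_complex_ofReal]
  simp

theorem integral_Ioi_one_exp_neg_mul {w : ℂ} (hw : 0 < w.re) :
    ∫ v in Ioi (1 : ℝ), Complex.exp (-((v : ℂ) * w)) = Complex.exp (-w) / w := by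
  have h := integral_exp_mul_complex_Ioi (a := -w) (by simpa using hw) 1
  simp only [Complex.ofReal_one, mul_one, neg_div_neg_eq] at h
  rw [← h]
  simp only [neg_mul, mul_comm w]

theorem integrableOn_Ioi_one_exp_neg_mul {x : ℝ} (hx : 0 < x) :
    IntegrableOn (fun v : ℝ => Real.exp (-(v * x))) (Ioi 1) := by
  have := exp_neg_integrableOn_Ioi 1 hx
  simpa only [neg_mul, mul_comm x] using this

theorem norm_inv_mul_exp_le {v : ℝ} (hv : 1 < v) (w : ℂ) :
    ‖(v : ℂ)⁻¹ * Complex.exp (-((v : ℂ) * w))‖ ≤ Real.exp (-(v * w.re)) := by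
  rw [norm_mul, Complex.norm_exp, norm_inv, Complex.norm_real, Real.norm_eq_abs,
    abs_of_pos (by linarith)]
  simp only [Complex.neg_re, Complex.re_ofReal_mul]
  exact mul_le_of_le_one_left (Real.exp_pos _).le (inv_le_one_of_one_le₀ hv.le)

theorem integrableOn_expInt {w : ℂ} (hw : 0 < w.re) :
    IntegrableOn (fun v : ℝ => (v : ℂ)⁻¹ * Complex.exp (-((v : ℂ) * w))) (Ioi 1) := by
  refine Integrable.mono' (integrableOn_Ioi_one_exp_neg_mul hw)
    (Measurable.aestronglyMeasurable (by fun_prop)) ?_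
  filter_upwards [ae_restrict_mem measurableSet_Ioi] with v hv
  exact norm_inv_mul_exp_le hv w

theorem norm_expInt_le {w : ℂ} (hw : 0 < w.re) :
    ‖expInt w‖ ≤ Real.exp (-w.re) / w.re := by
  have h1 : ∫ v in Ioi (1 : ℝ), Real.exp (-(v * w.re)) = Real.exp (-w.re) / w.re := by
    have := integral_Ioi_one_exp_neg_mul (w := (w.re : ℂ)) (by simpa using hw)
    have h2 : ∀ v : ℝ, Complex.exp (-((v : ℂ) * (w.re : ℂ))) =
        ((Real.exp (-(v * w.re)) : ℝ) : ℂ) := fun v => by push_cast; rfl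
    simp only [h2, integral_complex_ofReal] at this
    exact_mod_cast this
  rw [← h1]
  refine norm_integral_le_of_norm_le (integrableOn_Ioi_one_exp_neg_mul hw) ?_
  filter_upwards [ae_restrict_mem measurableSet_Ioi] with v hv
  exact norm_inv_mul_exp_le hv w

theorem hasDerivAt_expInt {w : ℂ} (hw : 0 < w.re) :
    HasDerivAt expInt (-(Complex.exp (-w) / w)) w := by
  have hnhds : {x : ℂ | w.re / 2 < x.re} ∈ 𝓝 w :=
    (isOpen_lt continuous_const Complex.continuous_re).mem_nhds (by simp [hw])
  have h := (hasDerivAt_integral_of_dominated_loc_of_deriv_le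
    (μ := volume.restrict (Ioi (1 : ℝ)))
    (F := fun (x : ℂ) (v : ℝ) => (v : ℂ)⁻¹ * Complex.exp (-((v : ℂ) * x)))
    (F' := fun (x : ℂ) (v : ℝ) => -Complex.exp (-((v : ℂ) * x)))
    (bound := fun v => Real.exp (-(v * (w.re / 2)))) hnhds
    (Eventually.of_forall fun x => Measurable.aestronglyMeasurable (by fun_prop))
    (integrableOn_expInt hw)
    (Measurable.aestronglyMeasurable (by fun_prop)) ?_
    (integrableOn_Ioi_one_exp_neg_mul (by positivity)) ?_).2
  · rwa [integral_neg, integral_Ioi_one_exp_neg_mul hw] at h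
  · filter_upwards [ae_restrict_mem measurableSet_Ioi] with v hv x hx
    have hv : 1 < v := hv
    have hx : w.re / 2 < x.re := hx
    rw [norm_neg, Complex.norm_exp, Real.exp_le_exp]
    simp only [Complex.neg_re, Complex.re_ofReal_mul]
    nlinarith
  · filter_upwards [ae_restrict_mem measurableSet_Ioi] with v hv x hx
    have hv : (v : ℂ) ≠ 0 := by
      have : (0 : ℝ) < v := lt_trans one_pos hv
      exact_mod_cast this.ne'
    have h2 := (((hasDerivAt_id x).const_mul (v : ℂ)).neg.cexp).const_mul (v : ℂ)⁻¹
    refine h2.congr_deriv ?_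
    simp only [id, Pi.neg_apply, mul_one]
    field_simp

end SpecialMellin

/-! ### Geometry of the wedge and bounds for the integrand on it. -/

section Wedge

/-- The point at distance `r` from `c` on the half-line with direction `exp(iφ)`. -/
noncomputable def rayPoint (c φ r : ℝ) : ℂ :=
  (c : ℂ) + (r : ℂ) * Complex.exp ((φ : ℂ) * Complex.I)

theorem rayPoint_re (c φ r : ℝ) : (rayPoint c φ r).re = c + r * Real.cos φ := by
  simp [rayPoint, Complex.exp_ofReal_mul_I_re]

theorem rayPoint_im (c φ r : ℝ) : (rayPoint c φ r).im = r * Real.sin φ := by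
  simp [rayPoint, Complex.exp_ofReal_mul_I_im]

theorem cos_sin_pi_div_eight : 0 < Real.cos (Real.pi / 8) ∧ 0 < Real.sin (Real.pi / 8) ∧
    Real.cos (Real.pi / 8) ^ 2 - Real.sin (Real.pi / 8) ^ 2 =
      2 * Real.sin (Real.pi / 8) * Real.cos (Real.pi / 8) ∧
    Real.cos (Real.pi / 8) ≤ 4 * Real.sin (Real.pi / 8) ∧
    Real.sin (Real.pi / 8) ≤ Real.cos (Real.pi / 8) ∧
    1 / 2 ≤ Real.cos (Real.pi / 8) ^ 2 - Real.sin (Real.pi / 8) ^ 2 := by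
  have hpi := Real.pi_pos
  have hC : 0 < Real.cos (Real.pi / 8) := Real.cos_pos_of_mem_Ioo ⟨by linarith, by linarith⟩
  have hS : 0 < Real.sin (Real.pi / 8) := Real.sin_pos_of_pos_of_lt_pi (by linarith) (by linarith)
  have h1 := Real.sin_sq_add_cos_sq (Real.pi / 8)
  have h2 := Real.cos_two_mul' (Real.pi / 8)
  have h3 := Real.sin_two_mul (Real.pi / 8)
  rw [show 2 * (Real.pi / 8) = Real.pi / 4 by ring, Real.cos_pi_div_four] at h2
  rw [show 2 * (Real.pi / 8) = Real.pi / 4 by ring, Real.sin_pi_div_four] at h3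
  have h4 : (1 : ℝ) ≤ √2 := Real.one_le_sqrt.mpr (by norm_num)
  have hC1 := Real.cos_le_one (Real.pi / 8)
  refine ⟨hC, hS, by linarith, ?_, ?_, by linarith⟩
  · nlinarith
  · nlinarith

/-- The square of a point of the wedge lies in the sector `|Im u| ≤ Re u`, away from `[c², ∞)`. -/
theorem rayPoint_sq {c φ r : ℝ} (hc : 0 < c) (hr : 0 ≤ r)
    (hφ : φ = Real.pi / 8 ∨ φ = -(Real.pi / 8)) :
    |((rayPoint c φ r) ^ 2).im| ≤ ((rayPoint c φ r) ^ 2).re ∧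
    c ^ 2 + r ^ 2 / 2 ≤ ((rayPoint c φ r) ^ 2).re ∧
    ((rayPoint c φ r) ^ 2).re - c ^ 2 ≤ 4 * |((rayPoint c φ r) ^ 2).im| := by
  obtain ⟨hC, hS, h1, h2, h3, h4⟩ := cos_sin_pi_div_eight
  set C := Real.cos (Real.pi / 8)
  set S := Real.sin (Real.pi / 8)
  have hre : ((rayPoint c φ r) ^ 2).re = (c + r * C) ^ 2 - (r * S) ^ 2 := by
    rw [pow_two, Complex.mul_re, rayPoint_re, rayPoint_im]
    rcases hφ with rfl | rfl
    · ring
    · rw [Real.cos_neg, Real.sin_neg]; ring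
  have him : |((rayPoint c φ r) ^ 2).im| = 2 * (c + r * C) * (r * S) := by
    rw [pow_two, Complex.mul_im, rayPoint_re, rayPoint_im]
    rcases hφ with rfl | rfl
    · rw [abs_of_nonneg (by positivity)]; ring
    · rw [Real.cos_neg, Real.sin_neg, abs_of_nonpos]
      · ring
      · have : 0 ≤ (c + r * C) * (r * S) := by positivity
        linarith
  have hcr : 0 ≤ c * r := by positivity
  have hr2 : 0 ≤ r ^ 2 := by positivity
  rw [hre, him]
  -- Re = c² + 2crC + r²(C² - S²) and |Im| = 2crS + 2r²SC; each bound holds coefficient by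
  -- coefficient.
  refine ⟨?_, ?_, ?_⟩
  · nlinarith [mul_le_mul_of_nonneg_left h3 hcr, congrArg (r ^ 2 * ·) h1]
  · nlinarith [mul_le_mul_of_nonneg_left h4 hr2, mul_nonneg hcr hC.le]
  · nlinarith [mul_le_mul_of_nonneg_left h2 hcr, congrArg (r ^ 2 * ·) h1,
      mul_le_mul_of_nonneg_left h4 hr2]

theorem norm_rayPoint_le {c φ r : ℝ} (hc : 0 < c) (hr : 0 ≤ r) : ‖rayPoint c φ r‖ ≤ c + r := by
  refine (norm_add_le _ _).trans ?_
  rw [norm_mul, Complex.norm_exp_ofReal_mul_I, Complex.norm_real, Complex.norm_real,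
    Real.norm_of_nonneg hc.le, Real.norm_of_nonneg hr, mul_one]

theorem rayPoint_sq_im (c φ r : ℝ) :
    ((rayPoint c φ r) ^ 2).im = 2 * (c + r * Real.cos φ) * (r * Real.sin φ) := by
  rw [pow_two, Complex.mul_im, rayPoint_re, rayPoint_im]
  ring

theorem rayPoint_ne_zero {c φ r : ℝ} (hc : 0 < c) (hr : 0 ≤ r)
    (hφ : φ = Real.pi / 8 ∨ φ = -(Real.pi / 8)) : rayPoint c φ r ≠ 0 := by
  intro h
  have := (rayPoint_sq hc hr hφ).2.1
  rw [h] at this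
  simp at this
  nlinarith

/-- For small u this is the power series bound. Otherwise the hypothesis keeps u away from 1, so
log|1 - u| is controlled, and constants such as the bound π for the argument are absorbed because
‖u‖ > 1/2. -/
theorem norm_log_one_sub_le {u : ℂ} {q : ℝ} (hq : q < 1) (hu : u.re - q ≤ 4 * |u.im|) :
    ‖Complex.log (1 - u)‖ ≤ (11 + 10 / (1 - q)) * ‖u‖ := by
  have hq' : 0 < 1 - q := by linarith
  by_cases hsmall : ‖u‖ ≤ 1 / 2
  · rw [sub_eq_add_neg]
    refine (Complex.norm_log_one_add_half_le_self (by rwa [norm_neg])).trans ?_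
    rw [norm_neg]
    gcongr
    have : 0 ≤ 10 / (1 - q) := by positivity
    linarith
  · rw [not_le] at hsmall
    have h1 : |u.im| ≤ ‖1 - u‖ := by
      simpa using Complex.abs_im_le_norm (1 - u)
    have h2 : 1 - u.re ≤ ‖1 - u‖ := by
      simpa using Complex.re_le_norm (1 - u)
    -- 1 - q = (1 - Re u) + (Re u - q) ≤ ‖1 - u‖ + 4‖1 - u‖.
    have hδ : (1 - q) / 5 ≤ ‖1 - u‖ := by linarith
    have hpos : 0 < ‖1 - u‖ := lt_of_lt_of_le (by positivity) hδ
    have h3 : ‖1 - u‖ ≤ 1 + ‖u‖ := by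
      simpa using norm_sub_le (1 : ℂ) u
    have h4 : ‖1 - u‖⁻¹ ≤ 5 / (1 - q) := by
      rw [← inv_div]
      exact inv_anti₀ (by positivity) hδ
    have h5 : |Real.log ‖1 - u‖| ≤ ‖u‖ + 5 / (1 - q) := by
      have hp : 0 < 5 / (1 - q) := by positivity
      refine abs_le.mpr ⟨?_, ?_⟩
      · have := Real.log_le_sub_one_of_pos (inv_pos.mpr hpos)
        rw [Real.log_inv] at this
        linarith
      · have := Real.log_le_sub_one_of_pos hpos
        linarith
    have h6 : ‖Complex.log (1 - u)‖ ≤ |Real.log ‖1 - u‖| + Real.pi := by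
      refine (Complex.norm_le_abs_re_add_abs_im _).trans ?_
      rw [Complex.log_re, Complex.log_im]
      gcongr
      exact Complex.abs_arg_le_pi _
    have h7 : 5 / (1 - q) ≤ 10 / (1 - q) * ‖u‖ := by
      have : 10 / (1 - q) * ‖u‖ = 5 / (1 - q) * (2 * ‖u‖) := by ring
      rw [this]
      exact le_mul_of_one_le_right (by positivity) (by linarith)
    have := Real.pi_le_four
    nlinarith

/-- `Log(1 - z²/A)` is `O(z²/A)` on the wedge, uniformly in `A`. -/
theorem norm_log_one_sub_rayPoint_le {A c φ r q : ℝ} (hc : 0 < c) (hA : 0 < A) (hq : q < 1)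
    (hcA : c ^ 2 ≤ q * A) (hr : 0 ≤ r) (hφ : φ = Real.pi / 8 ∨ φ = -(Real.pi / 8)) :
    ‖Complex.log (1 - (rayPoint c φ r) ^ 2 / (A : ℂ))‖ ≤
      (11 + 10 / (1 - q)) * (‖rayPoint c φ r‖ ^ 2 / A) := by
  have h := (rayPoint_sq hc hr hφ).2.2
  have h1 := norm_log_one_sub_le (u := (rayPoint c φ r) ^ 2 / (A : ℂ)) hq ?_
  · rwa [norm_div, norm_pow, Complex.norm_real, Real.norm_of_nonneg hA.le] at h1
  · rw [Complex.div_ofReal_re, Complex.div_ofReal_im, abs_div, abs_of_pos hA, ← mul_div_assoc,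
      sub_le_iff_le_add, ← sub_le_iff_le_add', div_sub_div_same, div_le_iff₀ hA]
    linarith

theorem rayPoint_sq_slit {A c φ r : ℝ} (hc : 0 < c) (hcA : c ^ 2 < A) (hr : 0 ≤ r)
    (hφ : φ = Real.pi / 8 ∨ φ = -(Real.pi / 8)) :
    1 - (rayPoint c φ r) ^ 2 / (A : ℂ) ∈ Complex.slitPlane := by
  have hA : 0 < A := lt_trans (by positivity) hcA
  have h := (rayPoint_sq hc hr hφ).2.2
  rw [Complex.mem_slitPlane_iff, Complex.sub_re, Complex.sub_im, Complex.div_ofReal_re,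
    Complex.div_ofReal_im]
  by_cases him : ((rayPoint c φ r) ^ 2).im = 0
  · left
    rw [him] at h
    simp only [abs_zero, mul_zero] at h
    rw [Complex.one_re, sub_pos, div_lt_one hA]
    linarith
  · right
    rw [Complex.one_im, zero_sub, neg_ne_zero]
    exact div_ne_zero him hA.ne'

theorem hasDerivAt_rayPoint (c φ r : ℝ) :
    HasDerivAt (rayPoint c φ) (Complex.exp ((φ : ℂ) * Complex.I)) r := by
  have h := ((Complex.ofRealCLM.hasDerivAt (x := r)).mul_const
    (Complex.exp ((φ : ℂ) * Complex.I))).const_add (c : ℂ)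
  simp only [Complex.ofRealCLM_apply, Complex.ofReal_one, one_mul] at h
  exact h

theorem continuous_rayPoint (c φ : ℝ) : Continuous (rayPoint c φ) := by
  unfold rayPoint; fun_prop

/-- The contribution of one factor to the inner integrand. -/
noncomputable def wedgeTerm (A t : ℝ) (z : ℂ) : ℂ :=
  2 * Complex.exp (-(z ^ 2 * (t : ℂ))) / z * Complex.log (1 - z ^ 2 / (A : ℂ))

/-- An integrable majorant on the two half-lines of the wedge. -/
noncomputable def wedgeBound (c t r : ℝ) : ℝ := (c + r) * Real.exp (-(t / 2) * r ^ 2)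

theorem integrableOn_wedgeBound (c : ℝ) {t : ℝ} (ht : 0 < t) :
    IntegrableOn (wedgeBound c t) (Ioi 0) := by
  have h0 := integrableOn_rpow_mul_exp_neg_mul_sq (b := t / 2) (by positivity) (s := 0)
    (by norm_num)
  have h1 := integrableOn_rpow_mul_exp_neg_mul_sq (b := t / 2) (by positivity) (s := 1)
    (by norm_num)
  refine ((h0.const_mul c).add h1).congr (Eventually.of_forall fun r => ?_)
  simp only [Pi.add_apply, wedgeBound, Real.rpow_zero, Real.rpow_one]
  ring

/-- The quadratic bound on x absorbs the 1/z of the kernel and leaves one factor |z| ≤ c + r; the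
Gaussian comes from Re z² ≥ r²/2. -/
theorem norm_exp_kernel_le {c φ r t : ℝ} (hc : 0 < c) (ht : 0 < t) (hr : 0 ≤ r)
    (hφ : φ = Real.pi / 8 ∨ φ = -(Real.pi / 8)) {x : ℂ} {K : ℝ} (hK : 0 ≤ K)
    (hx : ‖x‖ ≤ K * ‖rayPoint c φ r‖ ^ 2) :
    ‖2 * Complex.exp (-((rayPoint c φ r) ^ 2 * (t : ℂ))) / rayPoint c φ r * x *
      Complex.exp ((φ : ℂ) * Complex.I)‖ ≤ 2 * K * wedgeBound c t r := by
  have h1 := (rayPoint_sq hc hr hφ).2.1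
  have hz : 0 < ‖rayPoint c φ r‖ := norm_pos_iff.mpr (rayPoint_ne_zero hc hr hφ)
  rw [norm_mul, Complex.norm_exp_ofReal_mul_I, mul_one, norm_mul, norm_div, norm_mul,
    Complex.norm_exp, Complex.norm_ofNat, Complex.neg_re, Complex.re_mul_ofReal, wedgeBound]
  calc 2 * Real.exp (-(((rayPoint c φ r) ^ 2).re * t)) / ‖rayPoint c φ r‖ * ‖x‖
      ≤ 2 * Real.exp (-(((rayPoint c φ r) ^ 2).re * t)) / ‖rayPoint c φ r‖ *
        (K * ‖rayPoint c φ r‖ ^ 2) := by gcongr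
    _ = 2 * K * (‖rayPoint c φ r‖ * Real.exp (-(((rayPoint c φ r) ^ 2).re * t))) := by
        field_simp
    _ ≤ _ := by
        gcongr
        · exact norm_rayPoint_le hc hr
        · nlinarith [sq_nonneg c]

theorem norm_rayIntegrand_wedgeTerm_le {A c φ r q t : ℝ} (hc : 0 < c) (hA : 0 < A) (hq : q < 1)
    (hcA : c ^ 2 ≤ q * A) (ht : 0 < t) (hr : 0 ≤ r)
    (hφ : φ = Real.pi / 8 ∨ φ = -(Real.pi / 8)) :
    ‖rayIntegrand (wedgeTerm A t) c φ r‖ ≤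
      2 * ((11 + 10 / (1 - q)) / A) * wedgeBound c t r := by
  have hq' : 0 < 1 - q := by linarith
  refine norm_exp_kernel_le hc ht hr hφ (by positivity) ?_
  refine (norm_log_one_sub_rayPoint_le hc hA hq hcA hr hφ).trans_eq ?_
  ring

theorem continuousOn_rayIntegrand_wedgeTerm {A c φ t : ℝ} (hc : 0 < c) (hcA : c ^ 2 < A)
    (hφ : φ = Real.pi / 8 ∨ φ = -(Real.pi / 8)) :
    ContinuousOn (rayIntegrand (wedgeTerm A t) c φ) (Ici 0) := by
  have h1 := (continuous_rayPoint c φ).continuousOn (s := Ici 0)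
  change ContinuousOn (fun r => 2 * Complex.exp (-((rayPoint c φ r) ^ 2 * (t : ℂ))) /
    rayPoint c φ r * Complex.log (1 - (rayPoint c φ r) ^ 2 / (A : ℂ)) *
      Complex.exp ((φ : ℂ) * Complex.I)) (Ici 0)
  refine ContinuousOn.mul (ContinuousOn.mul (ContinuousOn.div (by fun_prop) h1 fun r hr =>
    rayPoint_ne_zero hc hr hφ) (ContinuousOn.clog (by fun_prop) fun r hr =>
      rayPoint_sq_slit hc hcA hr hφ)) (by fun_prop)

theorem integrableOn_rayIntegrand_wedgeTerm {A c φ t : ℝ} (hc : 0 < c) (hcA : c ^ 2 < A)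
    (ht : 0 < t) (hφ : φ = Real.pi / 8 ∨ φ = -(Real.pi / 8)) :
    IntegrableOn (rayIntegrand (wedgeTerm A t) c φ) (Ioi 0) := by
  have hA : 0 < A := lt_trans (by positivity) hcA
  refine Integrable.mono' ((integrableOn_wedgeBound c ht).const_mul
    (2 * ((11 + 10 / (1 - c ^ 2 / A)) / A)))
    (((continuousOn_rayIntegrand_wedgeTerm hc hcA hφ).mono
      Ioi_subset_Ici_self).aestronglyMeasurable measurableSet_Ioi) ?_
  filter_upwards [ae_restrict_mem measurableSet_Ioi] with r hr
  exact norm_rayIntegrand_wedgeTerm_le hc hA (q := c ^ 2 / A) (by rwa [div_lt_one hA])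
    (by rw [div_mul_cancel₀ _ hA.ne']) ht (le_of_lt hr) hφ

end Wedge

/-! ### The wedge integral of a single factor. -/

section WedgeValue

/-- These discs touch the imaginary axis at 0: they stay in the half-plane where E₁ is holomorphic,
they exhaust the sector as M grows, and on a disc every holomorphic function has a primitive. -/
theorem mem_ball_of_sector {u : ℂ} {M : ℝ} (hu : |u.im| ≤ u.re) (hu0 : 0 < u.re) (hM : u.re < M) :
    u ∈ Metric.ball (M : ℂ) M := by
  have hM0 : 0 < M := hu0.trans hM
  rw [mem_ball_iff_norm]
  refine lt_of_pow_lt_pow_left₀ 2 hM0.le ?_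
  rw [Complex.sq_norm, Complex.normSq_apply, Complex.sub_re, Complex.sub_im, Complex.ofReal_re,
    Complex.ofReal_im, sub_zero]
  have h : u.im ^ 2 ≤ u.re ^ 2 := sq_le_sq.mpr (by rwa [abs_of_pos hu0])
  nlinarith

theorem re_pos_of_mem_ball {u : ℂ} {M : ℝ} (hu : u ∈ Metric.ball (M : ℂ) M) : 0 < u.re := by
  have h := (Complex.abs_re_le_norm _).trans_lt (mem_ball_iff_norm.mp hu)
  rw [Complex.sub_re, Complex.ofReal_re] at h
  linarith [(abs_lt.mp h).1]

theorem hasDerivAt_expInt_mul {t : ℝ} (ht : 0 < t) {u : ℂ} (hu : 0 < u.re) :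
    HasDerivAt (fun u : ℂ => expInt ((t : ℂ) * u)) (-(Complex.exp (-(u * (t : ℂ))) / u)) u := by
  have h1 : 0 < ((t : ℂ) * u).re := by rw [Complex.re_ofReal_mul]; positivity
  have ht0 : (t : ℂ) ≠ 0 := by exact_mod_cast ht.ne'
  have hu0 : u ≠ 0 := by rintro rfl; simp at hu
  have h2 := (hasDerivAt_expInt h1).comp u ((hasDerivAt_id u).const_mul (t : ℂ))
  refine h2.congr_deriv ?_
  rw [mul_comm u]
  field_simp

theorem norm_expInt_mul_le {t X : ℝ} (ht : 0 < t) (hX : 0 < X) {u : ℂ} (hu : X ≤ u.re) :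
    ‖expInt ((t : ℂ) * u)‖ ≤ Real.exp (-(t * X)) / (t * X) := by
  have h1 : t * X ≤ ((t : ℂ) * u).re := by rw [Complex.re_ofReal_mul]; gcongr
  have h2 : 0 < t * X := by positivity
  refine (norm_expInt_le (h2.trans_le h1)).trans ?_
  gcongr

/-- A primitive of the difference quotient of the exponential integral at `A`. -/
theorem exists_primitive_dslope_expInt {A t M : ℝ} (hA : 0 < A) (ht : 0 < t) (hAM : A < M) :
    ∃ Q : ℂ → ℂ, ∀ u ∈ Metric.ball (M : ℂ) M,
      HasDerivAt Q (dslope (fun u : ℂ => expInt ((t : ℂ) * u)) (A : ℂ) u) u := by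
  have hmem : (A : ℂ) ∈ Metric.ball (M : ℂ) M :=
    mem_ball_of_sector (by simpa using hA.le) (by simpa using hA) (by simpa using hAM)
  have h : DifferentiableOn ℂ (fun u : ℂ => expInt ((t : ℂ) * u)) (Metric.ball (M : ℂ) M) :=
    fun u hu => (hasDerivAt_expInt_mul ht (re_pos_of_mem_ball
      hu)).differentiableAt.differentiableWithinAt
  exact ((Complex.differentiableOn_dslope
    (Metric.isOpen_ball.mem_nhds hmem)).mpr h).isExactOn_ball

theorem hasDerivAt_log_one_sub_div {A : ℝ} (hA : 0 < A) {u : ℂ}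
    (hu : 1 - u / (A : ℂ) ∈ Complex.slitPlane) :
    HasDerivAt (fun u : ℂ => Complex.log (1 - u / (A : ℂ))) (1 / (u - A)) u := by
  have hA0 : (A : ℂ) ≠ 0 := by exact_mod_cast hA.ne'
  have h := (((hasDerivAt_id u).div_const (A : ℂ)).const_sub 1).clog hu
  refine h.congr_deriv ?_
  have h1 : 1 - u / (A : ℂ) ≠ 0 := Complex.slitPlane_ne_zero hu
  have h2 : 1 - u / (A : ℂ) = -((u - A) / A) := by field_simp; ring
  have h3 : u - A ≠ 0 := by
    intro h3; rw [h2, h3] at h1; simp at h1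
  simp only [id]
  rw [h2]
  field_simp

/-- This branch is holomorphic across the real axis beyond A, where log(1 - u/A) has its cut;
comparing the two measures the jump. -/
theorem hasDerivAt_log_div_sub_one {A : ℝ} (hA : 0 < A) {u : ℂ} (hu : A < u.re) :
    HasDerivAt (fun u : ℂ => Complex.log (u / (A : ℂ) - 1)) (1 / (u - A)) u := by
  have hA0 : (A : ℂ) ≠ 0 := by exact_mod_cast hA.ne'
  have hs : u / (A : ℂ) - 1 ∈ Complex.slitPlane := by
    refine Complex.mem_slitPlane_iff.mpr (Or.inl ?_)
    rw [Complex.sub_re, Complex.div_ofReal_re, Complex.one_re, sub_pos, one_lt_div hA]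
    exact hu
  have h := (((hasDerivAt_id u).div_const (A : ℂ)).sub_const 1).clog hs
  refine h.congr_deriv ?_
  have h3 : u - A ≠ 0 := by
    intro h3
    rw [sub_eq_zero] at h3
    rw [h3] at hu
    simp at hu
  have h2 : u / (A : ℂ) - 1 = (u - A) / A := by field_simp
  simp only [id]
  rw [h2]
  field_simp

/-- A primitive, in the variable `u = z²`, of the contribution of one factor. -/
noncomputable def wedgePrimitive (A t : ℝ) (Q : ℂ → ℂ) (u : ℂ) : ℂ :=
  -(expInt ((t : ℂ) * u) * Complex.log (1 - u / (A : ℂ))) +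
    (Q u + expInt ((t : ℂ) * (A : ℂ)) * Complex.log (1 - u / (A : ℂ)))

/-- Integration by parts leaves E₁(tu)/(u - A), which splits into the difference quotient of E₁(t·)
at A, with primitive Q, and E₁(tA)/(u - A), with a logarithm as primitive. -/
theorem hasDerivAt_wedgePrimitive {A t : ℝ} (hA : 0 < A) (ht : 0 < t) {Q : ℂ → ℂ} {u : ℂ}
    (hQ : HasDerivAt Q (dslope (fun u : ℂ => expInt ((t : ℂ) * u)) (A : ℂ) u) u)
    (hu : 0 < u.re) (hs : 1 - u / (A : ℂ) ∈ Complex.slitPlane) :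
    HasDerivAt (wedgePrimitive A t Q)
      (Complex.exp (-(u * (t : ℂ))) / u * Complex.log (1 - u / (A : ℂ))) u := by
  have hA0 : (A : ℂ) ≠ 0 := by exact_mod_cast hA.ne'
  have hne : u ≠ A := by
    rintro rfl
    rw [div_self hA0, sub_self] at hs
    exact Complex.slitPlane_ne_zero hs rfl
  have hne' : u - A ≠ 0 := sub_ne_zero.mpr hne
  have hL := hasDerivAt_log_one_sub_div hA hs
  have h := ((hasDerivAt_expInt_mul ht hu).mul hL).neg.add
    (hQ.add (hL.const_mul (expInt ((t : ℂ) * (A : ℂ)))))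
  refine h.congr_deriv ?_
  rw [dslope_of_ne _ hne, slope_def_field]
  field_simp
  ring

theorem intervalIntegral_rayIntegrand_wedgeTerm {A c φ t R : ℝ} (hc : 0 < c) (hcA : c ^ 2 < A)
    (ht : 0 < t) (hR : 0 ≤ R) (hφ : φ = Real.pi / 8 ∨ φ = -(Real.pi / 8)) {Q : ℂ → ℂ}
    (hQ : ∀ u ∈ Metric.ball (((c + R) ^ 2 + A + 1 : ℝ) : ℂ) ((c + R) ^ 2 + A + 1),
      HasDerivAt Q (dslope (fun u : ℂ => expInt ((t : ℂ) * u)) (A : ℂ) u) u) :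
    ∫ r in (0 : ℝ)..R, rayIntegrand (wedgeTerm A t) c φ r =
      wedgePrimitive A t Q ((rayPoint c φ R) ^ 2) - wedgePrimitive A t Q ((c : ℂ) ^ 2) := by
  have hA : 0 < A := lt_trans (by positivity) hcA
  have hd : ∀ r ∈ uIcc 0 R, HasDerivAt (fun r => wedgePrimitive A t Q ((rayPoint c φ r) ^ 2))
      (rayIntegrand (wedgeTerm A t) c φ r) r := by
    intro r hr
    rw [uIcc_of_le hR] at hr
    obtain ⟨h1, h2, -⟩ := rayPoint_sq hc hr.1 hφ
    have hpos : 0 < ((rayPoint c φ r) ^ 2).re := lt_of_lt_of_le (by positivity) h2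
    have hlt : ((rayPoint c φ r) ^ 2).re < (c + R) ^ 2 + A + 1 := by
      have h3 := Complex.re_le_norm ((rayPoint c φ r) ^ 2)
      rw [norm_pow] at h3
      have h4 : ‖rayPoint c φ r‖ ^ 2 ≤ (c + R) ^ 2 := by
        gcongr
        exact (norm_rayPoint_le hc hr.1).trans (by linarith [hr.2])
      linarith
    have h5 := hasDerivAt_wedgePrimitive hA ht (hQ _ (mem_ball_of_sector h1 hpos hlt)) hpos
      (rayPoint_sq_slit hc hcA hr.1 hφ)
    have h6 := HasDerivAt.comp r h5 ((hasDerivAt_rayPoint c φ r).pow 2)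
    refine h6.congr_deriv ?_
    have h7 := rayPoint_ne_zero hc hr.1 hφ
    change _ = wedgeTerm A t (rayPoint c φ r) * _
    rw [wedgeTerm]
    field_simp
    simp
    ring
  have h := intervalIntegral.integral_eq_sub_of_hasDerivAt hd
    (((continuousOn_rayIntegrand_wedgeTerm hc hcA hφ).mono (by
      rw [uIcc_of_le hR]; exact Icc_subset_Ici_self)).intervalIntegrable)
  rw [h]
  simp [rayPoint]

theorem log_neg_sub_log_of_im_neg {w : ℂ} (hw : w.im < 0) :
    Complex.log (-w) - Complex.log w = Real.pi * Complex.I := by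
  simp only [Complex.log, norm_neg, Complex.arg_neg_eq_arg_add_pi_of_im_neg hw]
  push_cast; ring

theorem log_neg_sub_log_of_im_pos {w : ℂ} (hw : 0 < w.im) :
    Complex.log (-w) - Complex.log w = -(Real.pi * Complex.I) := by
  simp only [Complex.log, norm_neg, Complex.arg_neg_eq_arg_sub_pi_of_im_pos hw]
  push_cast; ring

/-- The primitives cancel at the vertex. At the outer ends, passing from log(1 - u/A) to log(u/A -
1) costs ±πi, which produces 2πi E₁(tA). The rest is exponentially small: boundary terms E₁ · log,
and the increment of a function holomorphic across the real axis. -/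
theorem norm_truncated_wedge_sub_le {A c t R : ℝ} (hc : 0 < c) (hcA : c ^ 2 < A)
    (ht : 0 < t) (hR : 0 < R) (hX : A + 1 ≤ c ^ 2 + R ^ 2 / 2) :
    ‖(∫ r in (0 : ℝ)..R, rayIntegrand (wedgeTerm A t) c (-(Real.pi / 8)) r) -
        (∫ r in (0 : ℝ)..R, rayIntegrand (wedgeTerm A t) c (Real.pi / 8) r) -
        2 * Real.pi * Complex.I * expInt ((t : ℂ) * (A : ℂ))‖ ≤
      8 / t * (1 + (11 + 10 / (1 - c ^ 2 / A)) / A) * Real.exp (-(t * (c ^ 2 + R ^ 2 / 2))) := by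
  have hA : 0 < A := lt_trans (by positivity) hcA
  have hA0 : (A : ℂ) ≠ 0 := by exact_mod_cast hA.ne'
  -- X is a lower bound for Re u at both outer ends; X ≥ A + 1 gives |u - A| ≥ 1 on Re u ≥ X.
  set X := c ^ 2 + R ^ 2 / 2 with hXdef
  have hX0 : 0 < X := by linarith
  -- The disc has to contain A and the squares of both truncated half-lines, where |u| ≤ (c + R)².
  set M := (c + R) ^ 2 + A + 1 with hM
  obtain ⟨Q, hQ⟩ := exists_primitive_dslope_expInt (M := M) hA ht
    (by have : 0 ≤ (c + R) ^ 2 := by positivity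
        linarith)
  have hm : (-(Real.pi / 8)) = Real.pi / 8 ∨ (-(Real.pi / 8)) = -(Real.pi / 8) := Or.inr rfl
  have hp : Real.pi / 8 = Real.pi / 8 ∨ Real.pi / 8 = -(Real.pi / 8) := Or.inl rfl
  rw [intervalIntegral_rayIntegrand_wedgeTerm hc hcA ht hR.le hm hQ,
    intervalIntegral_rayIntegrand_wedgeTerm hc hcA ht hR.le hp hQ, sub_sub_sub_cancel_right]
  obtain ⟨hC, hS, -, -, -, -⟩ := cos_sin_pi_div_eight
  have hq : c ^ 2 / A < 1 := by rwa [div_lt_one hA]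
  have hqA : c ^ 2 ≤ c ^ 2 / A * A := by rw [div_mul_cancel₀ _ hA.ne']
  -- properties of the two endpoints
  have key : ∀ φ, (φ = Real.pi / 8 ∨ φ = -(Real.pi / 8)) →
      (rayPoint c φ R) ^ 2 ∈ Metric.ball (M : ℂ) M ∩ {u | X ≤ u.re} ∧
      ‖(rayPoint c φ R) ^ 2‖ ≤ 4 * X ∧
      ‖expInt ((t : ℂ) * (rayPoint c φ R) ^ 2) *
        Complex.log (1 - (rayPoint c φ R) ^ 2 / (A : ℂ))‖ ≤
        Real.exp (-(t * X)) / (t * X) * ((11 + 10 / (1 - c ^ 2 / A)) * (4 * X / A)) := by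
    intro φ hφ
    obtain ⟨h1, h2, -⟩ := rayPoint_sq hc hR.le hφ
    have h3 : ‖rayPoint c φ R‖ ^ 2 ≤ (c + R) ^ 2 := by
      gcongr
      exact norm_rayPoint_le hc hR.le
    have h4 : ‖rayPoint c φ R‖ ^ 2 ≤ 4 * X := by
      refine h3.trans ?_
      rw [hXdef]
      nlinarith [sq_nonneg (c - R), sq_nonneg c]
    have h5 := Complex.re_le_norm ((rayPoint c φ R) ^ 2)
    rw [norm_pow] at h5
    refine ⟨⟨mem_ball_of_sector h1 (hX0.trans_le h2) (by rw [hM]; linarith), h2⟩,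
      by rwa [norm_pow], ?_⟩
    rw [norm_mul]
    have h6 := norm_log_one_sub_rayPoint_le hc hA hq hqA hR.le hφ
    have h7 := norm_expInt_mul_le ht hX0 h2
    have h8 : 0 < 1 - c ^ 2 / A := by linarith
    refine mul_le_mul h7 (h6.trans ?_) (norm_nonneg _) (by positivity)
    gcongr
  obtain ⟨⟨hbm, hXm⟩, hnm, hem⟩ := key _ hm
  obtain ⟨⟨hbp, hXp⟩, hnp, hep⟩ := key _ hp
  have himm : ((rayPoint c (-(Real.pi / 8)) R) ^ 2 / (A : ℂ) - 1).im < 0 := by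
    rw [Complex.sub_im, Complex.div_ofReal_im, Complex.one_im, sub_zero, rayPoint_sq_im,
      Real.cos_neg, Real.sin_neg]
    refine div_neg_of_neg_of_pos ?_ hA
    have : 0 < (c + R * Real.cos (Real.pi / 8)) * (R * Real.sin (Real.pi / 8)) := by positivity
    linarith
  have himp : 0 < ((rayPoint c (Real.pi / 8) R) ^ 2 / (A : ℂ) - 1).im := by
    rw [Complex.sub_im, Complex.div_ofReal_im, Complex.one_im, sub_zero, rayPoint_sq_im]
    positivity
  have hlm := log_neg_sub_log_of_im_neg himm
  have hlp := log_neg_sub_log_of_im_pos himp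
  rw [neg_sub] at hlm hlp
  set um := (rayPoint c (-(Real.pi / 8)) R) ^ 2
  set up := (rayPoint c (Real.pi / 8) R) ^ 2
  set N : ℂ → ℂ := fun u =>
    Q u + expInt ((t : ℂ) * (A : ℂ)) * Complex.log (u / (A : ℂ) - 1) with hN
  have hNd : ∀ u ∈ Metric.ball (M : ℂ) M ∩ {u | X ≤ u.re},
      HasDerivWithinAt N (expInt ((t : ℂ) * u) / (u - A))
        (Metric.ball (M : ℂ) M ∩ {u | X ≤ u.re}) u := by
    rintro u ⟨hu1, hu2⟩
    have hu2 : X ≤ u.re := hu2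
    have hAu : A < u.re := by linarith
    have hne : u ≠ A := by rintro rfl; simp at hAu
    have h := (hQ u hu1).add ((hasDerivAt_log_div_sub_one hA hAu).const_mul
      (expInt ((t : ℂ) * (A : ℂ))))
    refine (h.congr_deriv ?_).hasDerivWithinAt
    have := sub_ne_zero.mpr hne
    rw [dslope_of_ne _ hne, slope_def_field]
    field_simp
    ring
  have hNb : ∀ u ∈ Metric.ball (M : ℂ) M ∩ {u | X ≤ u.re},
      ‖expInt ((t : ℂ) * u) / (u - A)‖ ≤ Real.exp (-(t * X)) / (t * X) := by
    rintro u ⟨-, hu2⟩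
    have hu2 : X ≤ u.re := hu2
    rw [norm_div]
    have h1 : 1 ≤ ‖u - A‖ := by
      have := Complex.re_le_norm (u - A)
      rw [Complex.sub_re, Complex.ofReal_re] at this
      linarith
    exact (div_le_self (norm_nonneg _) h1).trans (norm_expInt_mul_le ht hX0 hu2)
  -- The outer ends are joined inside a convex set on which N' is exponentially small, so the mean
  -- value inequality applies.
  have hconv : Convex ℝ (Metric.ball (M : ℂ) M ∩ {u | X ≤ u.re}) :=
    (convex_ball _ _).inter (convex_halfSpace_re_ge X)
  have hNdiff := hconv.norm_image_sub_le_of_norm_hasDerivWithin_le hNd hNb ⟨hbp, hXp⟩ ⟨hbm, hXm⟩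
  have hsub : ‖um - up‖ ≤ 8 * X := (norm_sub_le _ _).trans (by linarith)
  have hid : wedgePrimitive A t Q um - wedgePrimitive A t Q up -
      2 * Real.pi * Complex.I * expInt ((t : ℂ) * (A : ℂ)) =
      (N um - N up) - (expInt ((t : ℂ) * um) * Complex.log (1 - um / (A : ℂ)) -
        expInt ((t : ℂ) * up) * Complex.log (1 - up / (A : ℂ))) := by
    rw [wedgePrimitive, wedgePrimitive, hN]
    linear_combination expInt ((t : ℂ) * (A : ℂ)) * (hlm - hlp)
  rw [hid]
  have h8 : 0 < 1 - c ^ 2 / A := by linarith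
  have he0 : 0 ≤ Real.exp (-(t * X)) / (t * X) := by positivity
  calc _ ≤ Real.exp (-(t * X)) / (t * X) * (8 * X) +
        (Real.exp (-(t * X)) / (t * X) * ((11 + 10 / (1 - c ^ 2 / A)) * (4 * X / A)) +
          Real.exp (-(t * X)) / (t * X) * ((11 + 10 / (1 - c ^ 2 / A)) * (4 * X / A))) := by
        refine (norm_sub_le _ _).trans (add_le_add ?_ ((norm_sub_le _ _).trans
          (add_le_add hem hep)))
        exact hNdiff.trans (by gcongr)
    _ = _ := by
        field_simp
        ring

theorem wedgeIntegral_wedgeTerm {A c t : ℝ} (hc : 0 < c) (hcA : c ^ 2 < A) (ht : 0 < t) :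
    wedgeIntegral (wedgeTerm A t) c = 2 * Real.pi * Complex.I * expInt ((t : ℂ) * (A : ℂ)) := by
  have hm := intervalIntegral_tendsto_integral_Ioi 0
    (integrableOn_rayIntegrand_wedgeTerm hc hcA ht (Or.inr rfl)) tendsto_id
  have hp := intervalIntegral_tendsto_integral_Ioi 0
    (integrableOn_rayIntegrand_wedgeTerm hc hcA ht (Or.inl rfl)) tendsto_id
  refine tendsto_nhds_unique (hm.sub hp) ?_
  have hXtop : Tendsto (fun R : ℝ => c ^ 2 + R ^ 2 / 2) atTop atTop :=
    tendsto_atTop_add_const_left _ _ ((tendsto_pow_atTop two_ne_zero).atTop_div_const two_pos)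
  have hexp : Tendsto (fun R : ℝ => 8 / t * (1 + (11 + 10 / (1 - c ^ 2 / A)) / A) *
      Real.exp (-(t * (c ^ 2 + R ^ 2 / 2)))) atTop (𝓝 0) := by
    have := (Real.tendsto_exp_neg_atTop_nhds_zero.comp (hXtop.const_mul_atTop ht)).const_mul
      (8 / t * (1 + (11 + 10 / (1 - c ^ 2 / A)) / A))
    simpa using! this
  refine tendsto_sub_nhds_zero_iff.mp (squeeze_zero_norm' ?_ hexp)
  filter_upwards [eventually_gt_atTop 0, hXtop.eventually_ge_atTop (A + 1)] with R hR hX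
  exact norm_truncated_wedge_sub_le hc hcA ht hR hX

end WedgeValue

/-! ### Summation over the factors and the integral representation. -/

section InnerIntegral

variable {a : ℕ → ℝ}

theorem tendsto_sq_atTop_of_summable (ha0 : ∀ j, a j ≠ 0)
    (hsum : Summable fun j => 1 / (a j) ^ 2) : Tendsto (fun j => a j ^ 2) atTop atTop := by
  have h1 : Tendsto (fun j => 1 / a j ^ 2) atTop (𝓝[>] 0) :=
    tendsto_nhdsWithin_iff.mpr ⟨hsum.tendsto_atTop_zero, Eventually.of_forall fun j => by
      have := ha0 j
      change 0 < 1 / a j ^ 2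
      positivity⟩
  exact (tendsto_inv_nhdsGT_zero.comp h1).congr fun j => by simp

/-- Since a_j² → ∞, its minimum is attained. A common q makes the constant in the logarithm bound
independent of j, so ∑ 1/a_j² dominates. -/
theorem exists_lt_one_sq_le_mul (ha0 : ∀ j, a j ≠ 0) (hsum : Summable fun j => 1 / (a j) ^ 2)
    {c : ℝ} (hc : 0 < c) (hca : ∀ j, c < |a j|) :
    ∃ q < 1, ∀ j, c ^ 2 ≤ q * a j ^ 2 := by
  have h := tendsto_sq_atTop_of_summable ha0 hsum
  rw [← Nat.cofinite_eq_atTop] at h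
  obtain ⟨i, hi⟩ := h.exists_forall_le
  have hpos : 0 < a i ^ 2 := by have := ha0 i; positivity
  refine ⟨c ^ 2 / a i ^ 2, ?_, fun j => ?_⟩
  · rw [div_lt_one hpos, sq_lt_sq, abs_of_pos hc]
    exact hca i
  · rw [div_mul_eq_mul_div, le_div_iff₀ hpos]
    exact mul_le_mul_of_nonneg_left (hi j) (sq_nonneg c)

theorem rayPoint_mem_slitDomain {c φ r : ℝ} (hc : 0 < c) (hca : ∀ j, c < |a j|)
    (hφ : φ = Real.pi / 8 ∨ φ = -(Real.pi / 8)) : rayPoint c φ r ∈ slitDomain a := by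
  rintro j ⟨him, hre⟩
  have hS := cos_sin_pi_div_eight.2.1
  have hsin : Real.sin φ ≠ 0 := by
    rcases hφ with rfl | rfl
    · exact hS.ne'
    · rw [Real.sin_neg]; exact (neg_neg_of_pos hS).ne
  rw [rayPoint_im] at him
  have hr0 : r = 0 := (mul_eq_zero.mp him).resolve_right hsin
  rw [rayPoint_re, hr0, zero_mul, add_zero, abs_of_pos hc] at hre
  exact absurd hre (not_le.mpr (hca j))

theorem hasSum_rayIntegrand (hsum : Summable fun j => 1 / (a j) ^ 2) (c φ t r : ℝ) :
    HasSum (fun j => rayIntegrand (wedgeTerm (a j ^ 2) t) c φ r)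
      (rayIntegrand (innerIntegrand a t) c φ r) := by
  have h := (((summable_log_one_sub_sq_div hsum (rayPoint c φ r)).hasSum).mul_left
    (2 * Complex.exp (-((rayPoint c φ r) ^ 2 * (t : ℂ))) / rayPoint c φ r)).mul_right
      (Complex.exp ((φ : ℂ) * Complex.I))
  simpa only [rayIntegrand, innerIntegrand, wedgeTerm, Complex.ofReal_pow] using! h

theorem summable_wedge_majorant (hsum : Summable fun j => 1 / (a j) ^ 2) (C x : ℝ) :
    Summable fun j => 2 * (C / a j ^ 2) * x := by
  have h := (hsum.mul_left (2 * C)).mul_right x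
  refine h.congr fun j => ?_
  ring

theorem integrableOn_tsum_wedge_majorant (C c : ℝ) {t : ℝ} (ht : 0 < t) :
    IntegrableOn (fun r => ∑' j, 2 * (C / a j ^ 2) * wedgeBound c t r) (Ioi 0) := by
  simp only [tsum_mul_right]
  exact (integrableOn_wedgeBound c ht).const_mul _

theorem sq_lt_sq_of_lt_abs {c x : ℝ} (hc : 0 < c) (h : c < |x|) : c ^ 2 < x ^ 2 := by
  rwa [sq_lt_sq, abs_of_pos hc]

theorem integrableOn_rayIntegrand_innerIntegrand (ha0 : ∀ j, a j ≠ 0)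
    (hsum : Summable fun j => 1 / (a j) ^ 2) {c φ t : ℝ} (hc : 0 < c) (hca : ∀ j, c < |a j|)
    (ht : 0 < t) (hφ : φ = Real.pi / 8 ∨ φ = -(Real.pi / 8)) :
    IntegrableOn (rayIntegrand (innerIntegrand a t) c φ) (Ioi 0) := by
  obtain ⟨q, hq, hqa⟩ := exists_lt_one_sq_le_mul ha0 hsum hc hca
  refine Integrable.mono' (integrableOn_tsum_wedge_majorant (a := a) (11 + 10 / (1 - q)) c ht)
    (ContinuousOn.aestronglyMeasurable ?_ measurableSet_Ioi) ?_
  · have h1 := (continuous_rayPoint c φ).continuousOn (s := Ioi 0)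
    have h2 : ContinuousOn (fun r => logProduct a (rayPoint c φ r)) (Ioi 0) := fun r _ =>
      ((differentiableAt_logProduct ha0 hsum (rayPoint_mem_slitDomain hc hca
        hφ)).continuousAt.comp (continuous_rayPoint c φ).continuousAt).continuousWithinAt
    change ContinuousOn (fun r => 2 * Complex.exp (-((rayPoint c φ r) ^ 2 * (t : ℂ))) /
      rayPoint c φ r * logProduct a (rayPoint c φ r) * Complex.exp ((φ : ℂ) * Complex.I)) (Ioi 0)
    exact ((ContinuousOn.div (by fun_prop) h1 fun r hr =>
      rayPoint_ne_zero hc (le_of_lt hr) hφ).mul h2).mul (by fun_prop)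
  · filter_upwards [ae_restrict_mem measurableSet_Ioi] with r hr
    rw [← (hasSum_rayIntegrand hsum c φ t r).tsum_eq]
    exact tsum_of_norm_bounded (summable_wedge_majorant hsum _ _).hasSum fun j =>
      norm_rayIntegrand_wedgeTerm_le hc (by have := ha0 j; positivity) hq (hqa j) ht
        (le_of_lt hr) hφ

theorem hasSum_integral_rayIntegrand (ha0 : ∀ j, a j ≠ 0)
    (hsum : Summable fun j => 1 / (a j) ^ 2) {c φ t : ℝ} (hc : 0 < c) (hca : ∀ j, c < |a j|)
    (ht : 0 < t) (hφ : φ = Real.pi / 8 ∨ φ = -(Real.pi / 8)) :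
    HasSum (fun j => ∫ r in Ioi (0 : ℝ), rayIntegrand (wedgeTerm (a j ^ 2) t) c φ r)
      (∫ r in Ioi (0 : ℝ), rayIntegrand (innerIntegrand a t) c φ r) := by
  obtain ⟨q, hq, hqa⟩ := exists_lt_one_sq_le_mul ha0 hsum hc hca
  refine hasSum_integral_of_dominated_convergence
    (fun j r => 2 * ((11 + 10 / (1 - q)) / a j ^ 2) * wedgeBound c t r) (fun j =>
      (integrableOn_rayIntegrand_wedgeTerm hc (sq_lt_sq_of_lt_abs hc (hca j)) ht
        hφ).aestronglyMeasurable) (fun j => ?_)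
    (Eventually.of_forall fun r => summable_wedge_majorant hsum _ _)
    (integrableOn_tsum_wedge_majorant _ _ ht)
    (Eventually.of_forall fun r => hasSum_rayIntegrand hsum c φ t r)
  filter_upwards [ae_restrict_mem measurableSet_Ioi] with r hr
  exact norm_rayIntegrand_wedgeTerm_le hc (by have := ha0 j; positivity) hq (hqa j) ht
    (le_of_lt hr) hφ

theorem wedgeIntegral_innerIntegrand (ha0 : ∀ j, a j ≠ 0)
    (hsum : Summable fun j => 1 / (a j) ^ 2) {c t : ℝ} (hc : 0 < c) (hca : ∀ j, c < |a j|)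
    (ht : 0 < t) :
    wedgeIntegral (innerIntegrand a t) c =
      2 * Real.pi * Complex.I * ∑' j, expInt ((a j ^ 2 * t : ℝ) : ℂ) := by
  have h := (hasSum_integral_rayIntegrand ha0 hsum hc hca ht (Or.inr rfl)).sub
    (hasSum_integral_rayIntegrand ha0 hsum hc hca ht (Or.inl rfl))
  rw [← tsum_mul_left]
  refine (h.tsum_eq.symm.trans (tsum_congr fun j => ?_))
  have h1 := wedgeIntegral_wedgeTerm hc (sq_lt_sq_of_lt_abs hc (hca j)) ht
  rw [Complex.ofReal_mul, mul_comm ((a j ^ 2 : ℝ) : ℂ), ← h1, wedgeIntegral]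

theorem measurable_expInt_ofReal : Measurable fun t : ℝ => expInt t := by
  have h : Measurable (Function.uncurry fun (t v : ℝ) =>
      (v : ℂ)⁻¹ * Complex.exp (-((v : ℂ) * (t : ℂ)))) := by
    simp only [Function.uncurry_def]
    fun_prop
  exact (h.stronglyMeasurable.integral_prod_right (ν := volume.restrict (Ioi (1 : ℝ)))).measurable

theorem zetaTerm_eq (s : ℂ) (j : ℕ) : zetaTerm a s j = ((a j ^ 2 : ℝ) : ℂ) ^ (-s) := by
  rw [zetaTerm, Complex.cpow_neg, one_div]

/-- ∑ E₁(a_j² t) has Mellin transform ζ(s)Γ(s)/s, and s²/Γ(s+1) = s/Γ(s) removes the extra factor.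
-/
theorem zeta_integral_representation (ha0 : ∀ j, a j ≠ 0)
    (hsum : Summable fun j => 1 / (a j) ^ 2) {c : ℝ} (hc : 0 < c) (hca : ∀ j, c < |a j|) {s : ℂ}
    (hs : 0 < s.re) (hsummable : Summable (zetaTerm a s)) :
    IntegrableOn (outerIntegrand a c s) (Ioi 0) ∧
      zetaSeries a s = s ^ 2 / Complex.Gamma (s + 1) *
        ∫ t in Ioi (0 : ℝ), outerIntegrand a c s t := by
  have hs0 : s ≠ 0 := by rintro rfl; simp at hs
  have h := hasMellin_tsum_comp_mul measurable_expInt_ofReal (hasMellin_expInt hs).1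
    (b := fun j => a j ^ 2) (fun j => by have := ha0 j; positivity)
    (hsummable.congr fun j => zetaTerm_eq s j)
  rw [(hasMellin_expInt hs).2] at h
  have heq : ∀ t ∈ Ioi (0 : ℝ), (t : ℂ) ^ (s - 1) • ∑' j, expInt ((a j ^ 2 * t : ℝ) : ℂ) =
      outerIntegrand a c s t := by
    intro t ht
    have h1 : (Real.pi : ℂ) ≠ 0 := by exact_mod_cast Real.pi_ne_zero
    rw [outerIntegrand, wedgeIntegral_innerIntegrand ha0 hsum hc hca ht, smul_eq_mul]
    generalize ∑' j, expInt ((a j ^ 2 * t : ℝ) : ℂ) = x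
    field_simp
  refine ⟨IntegrableOn.congr_fun h.1 heq measurableSet_Ioi, ?_⟩
  rw [← setIntegral_congr_fun measurableSet_Ioi heq]
  have h2 := h.2
  rw [mellin] at h2
  rw [h2, Complex.Gamma_add_one s hs0, zetaSeries]
  simp only [zetaTerm_eq]
  have h3 := Complex.Gamma_ne_zero_of_re_pos hs
  field_simp

end InnerIntegral

/-! ### Growth on the imaginary axis, the leading term, and convergence of the zeta series. -/

section Growth

variable {a : ℕ → ℝ}

/-- The logarithm of the product on the imaginary axis. -/
noncomputable def imagLog (a : ℕ → ℝ) (y : ℝ) : ℝ := ∑' j, Real.log (1 + y ^ 2 / a j ^ 2)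

theorem log_one_add_sq_div_nonneg (y x : ℝ) : 0 ≤ Real.log (1 + y ^ 2 / x ^ 2) :=
  Real.log_nonneg (by have : 0 ≤ y ^ 2 / x ^ 2 := by positivity
                      linarith)

theorem log_one_add_sq_div_le (y x : ℝ) : Real.log (1 + y ^ 2 / x ^ 2) ≤ y ^ 2 * (1 / x ^ 2) := by
  have h0 : 0 ≤ y ^ 2 / x ^ 2 := by positivity
  have h := Real.log_le_sub_one_of_pos (x := 1 + y ^ 2 / x ^ 2) (by linarith)
  rw [mul_one_div]
  linarith

theorem summable_log_one_add_sq_div (hsum : Summable fun j => 1 / (a j) ^ 2) (y : ℝ) :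
    Summable fun j => Real.log (1 + y ^ 2 / a j ^ 2) :=
  Summable.of_nonneg_of_le (fun j => log_one_add_sq_div_nonneg y (a j))
    (fun j => log_one_add_sq_div_le y (a j)) (hsum.mul_left _)

theorem logProduct_I_mul (a : ℕ → ℝ) (y : ℝ) :
    logProduct a (Complex.I * y) = (imagLog a y : ℂ) := by
  rw [logProduct, imagLog, Complex.ofReal_tsum]
  refine tsum_congr fun j => ?_
  have h0 : 0 ≤ y ^ 2 / a j ^ 2 := by positivity
  rw [Complex.ofReal_log (by linarith), mul_pow, Complex.I_sq]
  push_cast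
  congr 1
  ring

theorem imagLog_nonneg (a : ℕ → ℝ) (y : ℝ) : 0 ≤ imagLog a y :=
  tsum_nonneg fun j => log_one_add_sq_div_nonneg y (a j)

theorem imagLog_le (hsum : Summable fun j => 1 / (a j) ^ 2) (y : ℝ) :
    imagLog a y ≤ y ^ 2 * ∑' j, 1 / a j ^ 2 := by
  rw [← tsum_mul_left]
  exact (summable_log_one_add_sq_div hsum y).tsum_le_tsum
    (fun j => log_one_add_sq_div_le y (a j)) (hsum.mul_left _)

theorem sum_le_imagLog (hsum : Summable fun j => 1 / (a j) ^ 2) (y : ℝ) (F : Finset ℕ) :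
    ∑ j ∈ F, Real.log (1 + y ^ 2 / a j ^ 2) ≤ imagLog a y :=
  (summable_log_one_add_sq_div hsum y).sum_le_tsum F
    fun j _ => log_one_add_sq_div_nonneg y (a j)

/-- Dominated convergence: after division by y² each term tends to 0 and stays below 1/a_j². -/
theorem tendsto_imagLog_div_sq (ha0 : ∀ j, a j ≠ 0) (hsum : Summable fun j => 1 / (a j) ^ 2) :
    Tendsto (fun y => imagLog a y / y ^ 2) atTop (𝓝 0) := by
  have h := tendsto_tsum_of_dominated_convergence (𝓕 := atTop)
    (f := fun (y : ℝ) j => Real.log (1 + y ^ 2 / a j ^ 2) / y ^ 2) (g := fun _ => (0 : ℝ)) hsum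
    (fun j => ?_) ?_
  · simpa only [tsum_zero, tsum_div_const] using! h
  · have ha2 : 0 < a j ^ 2 := by have := ha0 j; positivity
    have h1 : Tendsto (fun x : ℝ => Real.log x / x) atTop (𝓝 0) :=
      Real.isLittleO_log_id_atTop.tendsto_div_nhds_zero
    have h2 : Tendsto (fun y : ℝ => 1 + y ^ 2 / a j ^ 2) atTop atTop :=
      tendsto_atTop_add_const_left _ _
        ((tendsto_pow_atTop two_ne_zero).atTop_div_const ha2)
    have h3 : Tendsto (fun y : ℝ => (1 + y ^ 2 / a j ^ 2) / y ^ 2) atTop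
        (𝓝 (0 + 1 / a j ^ 2)) := by
      have h4 : Tendsto (fun y : ℝ => (y ^ 2)⁻¹ + 1 / a j ^ 2) atTop (𝓝 (0 + 1 / a j ^ 2)) :=
        (tendsto_inv_atTop_zero.comp (tendsto_pow_atTop two_ne_zero)).add_const _
      refine h4.congr' ?_
      filter_upwards [eventually_gt_atTop 0] with y hy
      field_simp
    have h5 := (h1.comp h2).mul h3
    rw [zero_mul] at h5
    refine h5.congr' ?_
    filter_upwards [eventually_gt_atTop 0] with y hy
    have : 0 < 1 + y ^ 2 / a j ^ 2 := by positivity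
    simp only [Function.comp_apply]
    rw [div_mul_div_cancel₀ this.ne']
  · filter_upwards [eventually_gt_atTop 0] with y hy j
    rw [Real.norm_of_nonneg (div_nonneg (log_one_add_sq_div_nonneg y (a j)) (sq_nonneg y)),
      div_le_iff₀ (by positivity), mul_comm]
    exact log_one_add_sq_div_le y (a j)

theorem exists_mul_log_sub_le_imagLog (ha0 : ∀ j, a j ≠ 0)
    (hsum : Summable fun j => 1 / (a j) ^ 2) (N : ℕ) :
    ∃ C, ∀ y, 0 < y → N * Real.log (y ^ 2) - C ≤ imagLog a y := by
  refine ⟨∑ j ∈ Finset.range N, Real.log (a j ^ 2), fun y hy => ?_⟩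
  refine le_trans ?_ (sum_le_imagLog hsum y (Finset.range N))
  have h : N * Real.log (y ^ 2) = ∑ _j ∈ Finset.range N, Real.log (y ^ 2) := by simp
  rw [h, ← Finset.sum_sub_distrib]
  refine Finset.sum_le_sum fun j _ => ?_
  have ha2 : 0 < a j ^ 2 := by have := ha0 j; positivity
  rw [← Real.log_div (by positivity) ha2.ne']
  exact Real.log_le_log (by positivity) (by linarith)

/-- The expansion on the imaginary axis, up to `O(1/y)`. -/
theorem HasLogExpansion.imagLog_bound {κ : ℕ} {d A B b₁ b₂ : ℝ}
    (h : HasLogExpansion a κ d A B b₁ b₂) :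
    ∃ C R : ℝ, 1 ≤ R ∧ ∀ y, R ≤ y →
      |imagLog a y + (d * y ^ κ + A * Real.log (y ^ 2) + B)| ≤ C / y := by
  have hpi := Real.pi_pos
  obtain ⟨C, R, hR, hb⟩ := h (Real.pi / 4) (by linarith) (by linarith)
  refine ⟨|C| + |b₁| + |b₂|, max R 1, le_max_right _ _, fun y hy => ?_⟩
  have hy1 : 1 ≤ y := (le_max_right _ _).trans hy
  have hy0 : 0 < y := by linarith
  have h1 := hb (y : ℂ) (by rw [Complex.arg_ofReal_of_nonneg hy0.le, abs_zero]; linarith)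
    (by rw [Complex.norm_real, Real.norm_of_nonneg hy0.le]; exact (le_max_left _ _).trans hy)
  rw [logProduct_I_mul, Complex.norm_real, Real.norm_of_nonneg hy0.le, ← Complex.ofReal_pow,
    ← Complex.ofReal_pow, ← Complex.ofReal_log (sq_nonneg y)] at h1
  have h2 : |-imagLog a y - (d * y ^ κ + A * Real.log (y ^ 2) + B + b₁ / y + b₂ / y ^ 2)| ≤
      C / y ^ 3 := by
    rw [← Real.norm_eq_abs, ← Complex.norm_real]
    push_cast
    push_cast at h1
    exact h1
  have h3 : C / y ^ 3 ≤ |C| / y :=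
    div_le_div₀ (abs_nonneg C) (le_abs_self C) hy0 (le_self_pow₀ hy1 (by norm_num))
  have h4 : |b₁ / y| = |b₁| / y := by rw [abs_div, abs_of_pos hy0]
  have h5 : |b₂ / y ^ 2| ≤ |b₂| / y := by
    rw [abs_div, abs_of_pos (by positivity : 0 < y ^ 2)]
    exact div_le_div_of_nonneg_left (abs_nonneg _) hy0 (le_self_pow₀ hy1 (by norm_num))
  have h6 : imagLog a y + (d * y ^ κ + A * Real.log (y ^ 2) + B) =
      -(-imagLog a y - (d * y ^ κ + A * Real.log (y ^ 2) + B + b₁ / y + b₂ / y ^ 2)) -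
        (b₁ / y + b₂ / y ^ 2) := by ring
  rw [h6]
  refine (abs_sub _ _).trans ?_
  rw [abs_neg, add_div, add_div, add_assoc (|C| / y)]
  exact add_le_add (h2.trans h3) ((abs_add_le _ _).trans (add_le_add h4.le h5))

theorem tendsto_log_sq_atTop : Tendsto (fun y : ℝ => Real.log (y ^ 2)) atTop atTop :=
  Real.tendsto_log_atTop.comp (tendsto_pow_atTop two_ne_zero)

/-- The leading term of the expansion is linear, and does not vanish. -/
theorem HasLogExpansion.eq_one_and_ne_zero (ha0 : ∀ j, a j ≠ 0)
    (hsum : Summable fun j => 1 / (a j) ^ 2) {κ : ℕ} {d A B b₁ b₂ : ℝ}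
    (h : HasLogExpansion a κ d A B b₁ b₂) : κ = 1 ∧ d ≠ 0 := by
  obtain ⟨C, R, hR, hb⟩ := h.imagLog_bound
  -- N > -A factors already outgrow -A log y². This excludes d = 0 and κ = 0, where the leading term
  -- is constant.
  have hlow : ¬ ∃ D : ℝ, ∀ y, R ≤ y → imagLog a y ≤ -A * Real.log (y ^ 2) + D := by
    rintro ⟨D, hD⟩
    obtain ⟨N, hN⟩ := exists_nat_gt (-A)
    obtain ⟨C', hC'⟩ := exists_mul_log_sub_le_imagLog ha0 hsum N
    have ht : Tendsto (fun y : ℝ => (N + A) * Real.log (y ^ 2)) atTop atTop :=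
      tendsto_log_sq_atTop.const_mul_atTop (by linarith)
    obtain ⟨y, hy1, hy2⟩ := ((ht.eventually_gt_atTop (D + C')).and (eventually_ge_atTop R)).exists
    have h1 := hC' y (by linarith)
    have h2 := hD y hy2
    nlinarith
  have hCy : ∀ y, R ≤ y → C / y ≤ |C| := fun y hy =>
    (div_le_div_of_nonneg_right (le_abs_self C) (by linarith)).trans
      (div_le_self (abs_nonneg C) (by linarith))
  have hd : d ≠ 0 := by
    rintro rfl
    refine hlow ⟨|C| - B, fun y hy => ?_⟩
    have h1 := (abs_le.mp (hb y hy)).2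
    have h2 := hCy y hy
    rw [zero_mul, zero_add] at h1
    linarith
  have hκ0 : κ ≠ 0 := by
    rintro rfl
    refine hlow ⟨|C| - B - d, fun y hy => ?_⟩
    have h1 := (abs_le.mp (hb y hy)).2
    have h2 := hCy y hy
    rw [pow_zero, mul_one] at h1
    linarith
  refine ⟨?_, hd⟩
  by_contra hκ1
  have hκ : 2 ≤ κ := by omega
  -- For κ ≥ 2 the expansion divided by y² bounds |d| by this quantity, which tends to 0.
  have hlim : Tendsto (fun y : ℝ => imagLog a y / y ^ 2 + |A| * (Real.log (y ^ 2) / y ^ 2) +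
      (|B| + |C|) * (y ^ 2)⁻¹) atTop (𝓝 (0 + |A| * 0 + (|B| + |C|) * 0)) := by
    have hsq : Tendsto (fun y : ℝ => y ^ 2) atTop atTop := tendsto_pow_atTop two_ne_zero
    have h1 : Tendsto (fun x : ℝ => Real.log x / x) atTop (𝓝 0) :=
      Real.isLittleO_log_id_atTop.tendsto_div_nhds_zero
    exact ((tendsto_imagLog_div_sq ha0 hsum).add ((h1.comp hsq).const_mul _)).add
      ((tendsto_inv_atTop_zero.comp hsq).const_mul _)
  have hle : ∀ᶠ y : ℝ in atTop, |d| ≤ imagLog a y / y ^ 2 +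
      |A| * (Real.log (y ^ 2) / y ^ 2) + (|B| + |C|) * (y ^ 2)⁻¹ := by
    filter_upwards [eventually_ge_atTop R] with y hy
    have hy1 : 1 ≤ y := by linarith
    have hy2 : 0 < y ^ 2 := by positivity
    have hlog : 0 ≤ Real.log (y ^ 2) := Real.log_nonneg (one_le_pow₀ hy1)
    have h1 : imagLog a y / y ^ 2 + |A| * (Real.log (y ^ 2) / y ^ 2) + (|B| + |C|) * (y ^ 2)⁻¹ =
        (imagLog a y + |A| * Real.log (y ^ 2) + (|B| + |C|)) / y ^ 2 := by
      field_simp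
    rw [h1, le_div_iff₀ hy2]
    have h2 : |d| * y ^ 2 ≤ |d * y ^ κ| := by
      rw [abs_mul, abs_of_pos (by positivity : 0 < y ^ κ)]
      gcongr
    have h3 : d * y ^ κ = (imagLog a y + (d * y ^ κ + A * Real.log (y ^ 2) + B)) -
        imagLog a y - A * Real.log (y ^ 2) - B := by ring
    have h4 : |d * y ^ κ| ≤ |C| + imagLog a y + |A| * Real.log (y ^ 2) + |B| := by
      rw [h3]
      refine (abs_sub _ _).trans (add_le_add ((abs_sub _ _).trans (add_le_add
        ((abs_sub _ _).trans (add_le_add ((hb y hy).trans (hCy y hy)) ?_)) ?_)) le_rfl)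
      · rw [abs_of_nonneg (imagLog_nonneg a y)]
      · rw [abs_mul, abs_of_nonneg hlog]
    linarith
  have := ge_of_tendsto hlim hle
  simp at this
  exact hd this

/-- A nonpositive a_j lies in [a_0, 0], so a_j² ≤ a_0², which fails for large j. -/
theorem eventually_pos_of_strictMono (ha : StrictMono a) (ha0 : ∀ j, a j ≠ 0)
    (hsum : Summable fun j => 1 / (a j) ^ 2) : ∀ᶠ j in atTop, 0 < a j := by
  filter_upwards [(tendsto_sq_atTop_of_summable ha0 hsum).eventually_gt_atTop (a 0 ^ 2)] with j hj
  by_contra hneg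
  rw [not_lt] at hneg
  have := ha.monotone (Nat.zero_le j)
  nlinarith

theorem tendsto_atTop_of_strictMono (ha : StrictMono a) (ha0 : ∀ j, a j ≠ 0)
    (hsum : Summable fun j => 1 / (a j) ^ 2) : Tendsto a atTop atTop := by
  have h := Real.tendsto_sqrt_atTop.comp (tendsto_sq_atTop_of_summable ha0 hsum)
  refine h.congr' ?_
  filter_upwards [eventually_pos_of_strictMono ha ha0 hsum] with j hj
  simp [Real.sqrt_sq hj.le]

/-- At y = a_(m+J) each of the m + 1 factors with J ≤ j ≤ m + J contributes at least log 2, so (m +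
1) log 2 ≤ K a_(m+J). The series is then compared with ∑ m^(-2 Re s). -/
theorem summable_zetaTerm_of_imagLog_le (ha : StrictMono a) (ha0 : ∀ j, a j ≠ 0)
    (hsum : Summable fun j => 1 / (a j) ^ 2) {K R : ℝ} (hK : 0 < K)
    (hbd : ∀ y, R ≤ y → imagLog a y ≤ K * y) {s : ℂ} (hs : 1 / 2 < s.re) :
    Summable (zetaTerm a s) := by
  obtain ⟨J, hJ⟩ := eventually_atTop.mp ((eventually_pos_of_strictMono ha ha0 hsum).and
    ((tendsto_atTop_of_strictMono ha ha0 hsum).eventually_ge_atTop R))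
  have hlog2 : 0 < Real.log 2 := Real.log_pos one_lt_two
  have hcount : ∀ m : ℕ, ((m + 1 : ℕ) : ℝ) * (Real.log 2 / K) ≤ a (m + J) := by
    intro m
    obtain ⟨hpos, hRm⟩ := hJ (m + J) (Nat.le_add_left _ _)
    have h1 := (sum_le_imagLog hsum (a (m + J)) (Finset.Icc J (m + J))).trans (hbd _ hRm)
    have h2 : ((m + 1 : ℕ) : ℝ) * Real.log 2 ≤
        ∑ j ∈ Finset.Icc J (m + J), Real.log (1 + a (m + J) ^ 2 / a j ^ 2) := by
      have h3 := Finset.card_nsmul_le_sum (Finset.Icc J (m + J))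
        (fun j => Real.log (1 + a (m + J) ^ 2 / a j ^ 2)) (Real.log 2) (fun j hj => by
          rw [Finset.mem_Icc] at hj
          have hj0 := (hJ j hj.1).1
          refine Real.log_le_log two_pos ?_
          have h4 : 1 ≤ a (m + J) ^ 2 / a j ^ 2 := by
            rw [one_le_div (by positivity)]
            have := ha.monotone hj.2
            gcongr
          linarith)
      rw [Nat.card_Icc, nsmul_eq_mul] at h3
      have h5 : m + J + 1 - J = m + 1 := by omega
      rwa [h5] at h3
    rw [mul_div_assoc', div_le_iff₀ hK, mul_comm (a (m + J))]
    exact h2.trans h1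
  refine (summable_nat_add_iff J).mp ?_
  have hps : Summable fun m : ℕ => (((m + 1 : ℕ) : ℝ) ^ (-(2 * s.re))) *
      (Real.log 2 / K) ^ (-(2 * s.re)) :=
    ((summable_nat_add_iff (f := fun n : ℕ => (n : ℝ) ^ (-(2 * s.re))) 1).mpr
      (Real.summable_nat_rpow.mpr (by linarith))).mul_right _
  refine Summable.of_norm_bounded hps fun m => ?_
  have hpos := (hJ (m + J) (Nat.le_add_left _ _)).1
  have hq : 0 < Real.log 2 / K := by positivity
  rw [zetaTerm_eq, Complex.norm_cpow_eq_rpow_re_of_pos (by positivity), Complex.neg_re,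
    ← Real.rpow_natCast, ← Real.rpow_mul hpos.le, ← Real.mul_rpow (by positivity) hq.le]
  have h6 : ((2 : ℕ) : ℝ) * -s.re = -(2 * s.re) := by push_cast; ring
  rw [h6]
  exact Real.rpow_le_rpow_of_nonpos (by positivity) (hcount m) (by linarith)

theorem HasLogExpansion.summable_zetaTerm (ha : StrictMono a) (ha0 : ∀ j, a j ≠ 0)
    (hsum : Summable fun j => 1 / (a j) ^ 2) {κ : ℕ} {d A B b₁ b₂ : ℝ}
    (h : HasLogExpansion a κ d A B b₁ b₂) {s : ℂ} (hs : 1 / 2 < s.re) :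
    Summable (zetaTerm a s) := by
  obtain ⟨rfl, -⟩ := h.eq_one_and_ne_zero ha0 hsum
  obtain ⟨C, R, hR, hb⟩ := h.imagLog_bound
  refine summable_zetaTerm_of_imagLog_le ha ha0 hsum (K := |C| + |d| + 2 * |A| + |B| + 1) (R := R)
    (by positivity) (fun y hy => ?_) hs
  have hy1 : 1 ≤ y := by linarith
  have h1 := (abs_le.mp (hb y hy)).2
  have h2 : C / y ≤ |C| * y := by
    refine (div_le_div_of_nonneg_right (le_abs_self C) (by linarith)).trans
      ((div_le_self (abs_nonneg C) hy1).trans (le_mul_of_one_le_right (abs_nonneg C) hy1))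
  have h3 : Real.log (y ^ 2) ≤ 2 * y := by
    rw [Real.log_pow]
    have := Real.log_le_self (x := y) (by linarith)
    push_cast
    linarith
  have h4 : 0 ≤ Real.log (y ^ 2) := Real.log_nonneg (one_le_pow₀ hy1)
  have h5 : -(A * Real.log (y ^ 2)) ≤ |A| * (2 * y) := by
    refine (neg_le_abs _).trans ?_
    rw [abs_mul, abs_of_nonneg h4]
    gcongr
  have h6 : -(d * y) ≤ |d| * y := by nlinarith [neg_abs_le d]
  have h7 : -B ≤ |B| * y := by nlinarith [neg_abs_le B, abs_nonneg B]
  rw [pow_one] at h1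
  nlinarith

end Growth

/-! ### Meromorphic continuation by Mellin transform. -/

section Continuation

variable {a : ℕ → ℝ}

theorem MellinConvergent.locallyIntegrableOn {f : ℝ → ℂ} {s : ℂ} (h : MellinConvergent f s) :
    LocallyIntegrableOn f (Ioi 0) := by
  have h1 : LocallyIntegrableOn (fun t : ℝ => (t : ℂ) ^ (s - 1) • f t) (Ioi 0) :=
    IntegrableOn.locallyIntegrableOn h
  have h2 : ContinuousOn (fun t : ℝ => (t : ℂ) ^ (1 - s)) (Ioi 0) := fun t ht =>
    (Complex.continuousAt_ofReal_cpow_const t _ (Or.inr (ne_of_gt ht))).continuousWithinAt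
  have h3 := h1.continuousOn_smul isOpen_Ioi.isLocallyClosed h2
  refine (locallyIntegrableOn_congr ?_).mp h3
  filter_upwards [ae_restrict_mem measurableSet_Ioi] with t ht
  have ht0 : (t : ℂ) ≠ 0 := by
    have : (0 : ℝ) < t := ht
    exact_mod_cast this.ne'
  rw [smul_smul, ← Complex.cpow_add _ _ ht0]
  simp

/-- Differentiation in s brings down log t, so this is the derivative of 1/s, the transform of the
indicator. -/
theorem hasMellin_log_Ioc {s : ℂ} (hs : 0 < s.re) :
    HasMellin (indicator (Ioc 0 1) (fun t : ℝ => ((Real.log t : ℝ) : ℂ))) s (-(1 / s ^ 2)) := by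
  have hs0 : s ≠ 0 := by rintro rfl; simp at hs
  set f : ℝ → ℂ := indicator (Ioc 0 1) (fun _ => 1) with hf
  have hloc : LocallyIntegrableOn f (Ioi 0) :=
    (hasMellin_one_Ioc (s := 1) (by simp)).1.locallyIntegrableOn
  have htop : f =O[atTop] fun x : ℝ => x ^ (-(s.re + 1)) := by
    refine (isBigO_zero _ _).congr' ?_ EventuallyEq.rfl
    filter_upwards [eventually_gt_atTop 1] with x hx
    rw [hf, indicator_of_notMem (fun h => absurd h.2 (not_le.mpr hx))]
  have hbot : f =O[𝓝[>] 0] fun x : ℝ => x ^ (-(0 : ℝ)) := by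
    refine IsBigO.of_bound 1 (Eventually.of_forall fun x => ?_)
    rw [neg_zero, Real.rpow_zero, norm_one, mul_one, hf]
    by_cases hx : x ∈ Ioc (0 : ℝ) 1
    · simp [hx]
    · simp [hx]
  obtain ⟨h1, h2⟩ := mellin_hasDerivAt_of_isBigO_rpow hloc htop (lt_add_one _) hbot hs
  have h3 : HasDerivAt (mellin f) (-(1 / s ^ 2)) s := by
    have h4 := hasDerivAt_inv hs0
    rw [inv_eq_one_div] at h4
    refine h4.congr_of_eventuallyEq ?_
    filter_upwards [(isOpen_lt continuous_const Complex.continuous_re).mem_nhds hs] with w hw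
    rw [(hasMellin_one_Ioc hw).2, one_div]
  have h5 : HasMellin (fun t => Real.log t • f t) s (-(1 / s ^ 2)) := ⟨h1, h2.unique h3⟩
  refine h5.congr fun t _ => ?_
  by_cases ht : t ∈ Ioc (0 : ℝ) 1
  · simp [hf, ht]
  · simp [hf, ht]

/-- The singular part at `0` of the logarithm of the product, in the variable `t = y⁻²`. -/
noncomputable def singularPart (d A B : ℝ) : ℝ → ℂ :=
  indicator (Ioc 0 1) fun t : ℝ =>
    (d : ℂ) * (t : ℂ) ^ (-(1 / 2) : ℂ) - (A : ℂ) * ((Real.log t : ℝ) : ℂ) + (B : ℂ)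

theorem hasMellin_singularPart (d A B : ℝ) {s : ℂ} (hs : 1 / 2 < s.re) :
    HasMellin (singularPart d A B) s
      ((d : ℂ) / (s - 1 / 2) + (A : ℂ) / s ^ 2 + (B : ℂ) / s) := by
  have hs0 : 0 < s.re := by linarith
  have h1 := hasMellin_cpow_Ioc (-(1 / 2)) (s := s) (by norm_num; linarith)
  have h2 := hasMellin_log_Ioc hs0
  have h3 := hasMellin_one_Ioc hs0
  have h4 := hasMellin_sub (h1.1.const_smul (d : ℂ)) (h2.1.const_smul (A : ℂ))
  have h5 := hasMellin_add h4.1 (h3.1.const_smul (B : ℂ))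
  rw [h4.2, mellin_const_smul, mellin_const_smul, mellin_const_smul, h1.2, h2.2, h3.2] at h5
  have h6 : (d : ℂ) • (1 / (s + -(1 / 2))) - (A : ℂ) • (-(1 / s ^ 2)) + (B : ℂ) • (1 / s) =
      (d : ℂ) / (s - 1 / 2) + (A : ℂ) / s ^ 2 + (B : ℂ) / s := by
    simp only [smul_eq_mul, ← sub_eq_add_neg]
    ring
  rw [h6] at h5
  refine h5.congr fun t _ => ?_
  by_cases ht : t ∈ Ioc (0 : ℝ) 1
  · simp only [singularPart, indicator_of_mem ht, smul_eq_mul, mul_one]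
  · simp only [singularPart, indicator_of_notMem ht, smul_eq_mul, mul_zero, sub_zero, add_zero]

/-- The logarithm of the product on the imaginary axis, in the variable `t = y⁻²`. -/
noncomputable def dilatedLog (a : ℕ → ℝ) (t : ℝ) : ℂ :=
  ∑' j, ((Real.log (1 + 1 / (a j ^ 2 * t)) : ℝ) : ℂ)

theorem dilatedLog_eq (a : ℕ → ℝ) {t : ℝ} (ht : 0 < t) :
    dilatedLog a t = (imagLog a (t ^ (-(1 / 2) : ℝ)) : ℂ) := by
  rw [dilatedLog, imagLog, Complex.ofReal_tsum]
  refine tsum_congr fun j => ?_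
  have h : (t ^ (-(1 / 2) : ℝ)) ^ 2 = t⁻¹ := by
    rw [← Real.rpow_natCast, ← Real.rpow_mul ht.le, ← Real.rpow_neg_one]
    norm_num
  rw [h]
  congr 3
  rw [one_div, mul_inv, div_eq_mul_inv, mul_comm]

theorem hasMellin_dilatedLog (ha0 : ∀ j, a j ≠ 0) {s : ℂ} (hs : 0 < s.re) (hs1 : s.re < 1)
    (hsummable : Summable (zetaTerm a s)) :
    HasMellin (dilatedLog a) s
      (zetaSeries a s * (Complex.Gamma (1 - s) * Complex.Gamma s / s)) := by
  have h := hasMellin_tsum_comp_mul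
    (f := fun t : ℝ => ((Real.log (1 + 1 / t) : ℝ) : ℂ)) (by fun_prop)
    (hasMellin_log_one_add_inv hs hs1).1
    (b := fun j => a j ^ 2) (fun j => by have := ha0 j; positivity)
    (hsummable.congr fun j => zetaTerm_eq s j)
  rw [(hasMellin_log_one_add_inv hs hs1).2] at h
  simpa only [zetaSeries, zetaTerm_eq] using! h

/-- Sets the right edge Re s < 1 of the strip; the cut-off at t = 1 keeps the singular part out. -/
theorem dilatedLog_isBigO_atTop (hsum : Summable fun j => 1 / (a j) ^ 2) (d A B : ℝ) :
    (fun t => dilatedLog a t + singularPart d A B t) =O[atTop] fun t : ℝ => t ^ (-(1 : ℝ)) := by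
  refine IsBigO.of_bound (∑' j, 1 / a j ^ 2) ?_
  filter_upwards [eventually_gt_atTop 1] with t ht
  have ht0 : 0 < t := by linarith
  rw [singularPart, indicator_of_notMem (fun h => absurd h.2 (not_le.mpr ht)), add_zero,
    dilatedLog_eq a ht0, Complex.norm_real, Real.norm_of_nonneg (imagLog_nonneg _ _),
    Real.norm_of_nonneg (by positivity)]
  refine (imagLog_le hsum _).trans_eq ?_
  rw [mul_comm, ← Real.rpow_natCast, ← Real.rpow_mul ht0.le]
  norm_num

/-- Sets the left edge: the remainder O(1/y) is O(t^(1/2)), so Re s > -1/2 is allowed. -/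
theorem dilatedLog_isBigO_zero {d A B b₁ b₂ : ℝ} (h : HasLogExpansion a 1 d A B b₁ b₂) :
    (fun t => dilatedLog a t + singularPart d A B t) =O[𝓝[>] 0]
      fun t : ℝ => t ^ (-(-(1 / 2) : ℝ)) := by
  obtain ⟨C, R, hR, hb⟩ := h.imagLog_bound
  have hR0 : 0 < R := by linarith
  refine IsBigO.of_bound C ?_
  have hlim : Tendsto (fun t : ℝ => t ^ (-(1 / 2) : ℝ)) (𝓝[>] 0) atTop :=
    tendsto_rpow_neg_nhdsGT_zero (by norm_num)
  filter_upwards [hlim.eventually_ge_atTop R, self_mem_nhdsWithin,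
    mem_nhdsWithin_of_mem_nhds (Iio_mem_nhds (zero_lt_one' ℝ))] with t ht ht0 ht1
  have ht0 : 0 < t := ht0
  have ht1 : t < 1 := ht1
  have h1 := hb _ ht
  have hsq : (t ^ (-(1 / 2) : ℝ)) ^ 2 = t⁻¹ := by
    rw [← Real.rpow_natCast, ← Real.rpow_mul ht0.le, ← Real.rpow_neg_one]
    norm_num
  have h2 : C / t ^ (-(1 / 2) : ℝ) = C * t ^ (-(-(1 / 2) : ℝ)) := by
    rw [Real.rpow_neg ht0.le (-(1 / 2)), div_eq_mul_inv]
  rw [hsq, Real.log_inv, pow_one, h2] at h1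
  have h3 : dilatedLog a t + singularPart d A B t =
      ((imagLog a (t ^ (-(1 / 2) : ℝ)) +
        (d * t ^ (-(1 / 2) : ℝ) + A * -Real.log t + B) : ℝ) : ℂ) := by
    rw [singularPart, indicator_of_mem (show t ∈ Ioc (0 : ℝ) 1 from ⟨ht0, ht1.le⟩),
      dilatedLog_eq a ht0]
    push_cast [Complex.ofReal_cpow ht0.le]
    ring
  rw [h3, Complex.norm_real, Real.norm_eq_abs, Real.norm_of_nonneg (by positivity)]
  exact h1

/-- The Mellin transform of the logarithm of the product without its singular part. -/
noncomputable def regularMellin (a : ℕ → ℝ) (d A B : ℝ) : ℂ → ℂ :=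
  mellin fun t => dilatedLog a t + singularPart d A B t

theorem hasMellin_dilatedLog_add_singularPart (ha0 : ∀ j, a j ≠ 0) (d A B : ℝ) {s : ℂ}
    (hs : 1 / 2 < s.re) (hs1 : s.re < 1) (hsummable : Summable (zetaTerm a s)) :
    HasMellin (fun t => dilatedLog a t + singularPart d A B t) s
      (zetaSeries a s * (Complex.Gamma (1 - s) * Complex.Gamma s / s) +
        ((d : ℂ) / (s - 1 / 2) + (A : ℂ) / s ^ 2 + (B : ℂ) / s)) := by
  have h1 := hasMellin_dilatedLog ha0 (by linarith) hs1 hsummable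
  have h2 := hasMellin_singularPart d A B hs
  have h := hasMellin_add h1.1 h2.1
  rwa [h1.2, h2.2] at h

theorem differentiableAt_regularMellin (ha : StrictMono a) (ha0 : ∀ j, a j ≠ 0)
    (hsum : Summable fun j => 1 / (a j) ^ 2) {d A B b₁ b₂ : ℝ}
    (h : HasLogExpansion a 1 d A B b₁ b₂) {s : ℂ} (hs : -(1 / 2) < s.re) (hs1 : s.re < 1) :
    DifferentiableAt ℂ (regularMellin a d A B) s := by
  -- A sample point of 1/2 < Re s < 1, where both pieces converge; it serves only to give local
  -- integrability.
  have hc : (1 / 2 : ℝ) < ((3 / 4 : ℝ) : ℂ).re := by rw [Complex.ofReal_re]; norm_num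
  exact mellin_differentiableAt_of_isBigO_rpow
    (hasMellin_dilatedLog_add_singularPart ha0 d A B hc (by rw [Complex.ofReal_re]; norm_num)
      (h.summable_zetaTerm ha ha0 hsum hc)).1.locallyIntegrableOn
    (dilatedLog_isBigO_atTop hsum d A B) hs1 (dilatedLog_isBigO_zero h) hs

/-- The entire function `sin(πs)/(πs) = 1/(Γ(1+s)Γ(1-s))`. -/
noncomputable def invGammaProd (s : ℂ) : ℂ := (Complex.Gamma (1 + s))⁻¹ * (Complex.Gamma (1 - s))⁻¹

theorem differentiable_invGammaProd : Differentiable ℂ invGammaProd := by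
  have h := Complex.differentiable_one_div_Gamma
  have h1 : Differentiable ℂ fun s : ℂ => (Complex.Gamma (1 + s))⁻¹ :=
    h.comp (by fun_prop : Differentiable ℂ fun s : ℂ => 1 + s)
  have h2 : Differentiable ℂ fun s : ℂ => (Complex.Gamma (1 - s))⁻¹ :=
    h.comp (by fun_prop : Differentiable ℂ fun s : ℂ => 1 - s)
  exact h1.mul h2

theorem invGammaProd_zero : invGammaProd 0 = 1 := by simp [invGammaProd]

theorem invGammaProd_neg (s : ℂ) : invGammaProd (-s) = invGammaProd s := by
  rw [invGammaProd, invGammaProd, mul_comm, sub_neg_eq_add, sub_eq_add_neg]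

/-- An even function has vanishing derivative at 0. -/
theorem hasDerivAt_invGammaProd_zero : HasDerivAt invGammaProd 0 0 := by
  have h := (differentiable_invGammaProd 0).hasDerivAt
  have h1 : HasDerivAt (fun s => invGammaProd (-s)) (-deriv invGammaProd 0) 0 := by
    have h2 : HasDerivAt invGammaProd (deriv invGammaProd 0) (-(0 : ℂ)) := by rwa [neg_zero]
    have h3 := h2.comp (0 : ℂ) (hasDerivAt_neg (0 : ℂ))
    simpa [Function.comp_def] using h3
  simp only [invGammaProd_neg] at h1
  have h4 : deriv invGammaProd 0 = 0 := self_eq_neg.mp (h.unique h1)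
  rwa [h4] at h

/-- The continuation of the zeta series to the strip `-1/2 < Re s < 1`. -/
noncomputable def zetaStrip (a : ℕ → ℝ) (d A B : ℝ) (s : ℂ) : ℂ :=
  invGammaProd s * (s ^ 2 * regularMellin a d A B s - (d : ℂ) * s ^ 2 / (s - 1 / 2) - (A : ℂ) -
    (B : ℂ) * s)

theorem zetaStrip_eq_zetaSeries (ha0 : ∀ j, a j ≠ 0) (d A B : ℝ) {s : ℂ}
    (hs : 1 / 2 < s.re) (hs1 : s.re < 1) (hsummable : Summable (zetaTerm a s)) :
    zetaStrip a d A B s = zetaSeries a s := by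
  have hs0 : s ≠ 0 := by rintro rfl; simp at hs; linarith
  have h2 : s - 1 / 2 ≠ 0 := by
    intro h
    rw [sub_eq_zero] at h
    rw [h] at hs
    norm_num at hs
  have h3 : Complex.Gamma s ≠ 0 := Complex.Gamma_ne_zero_of_re_pos (by linarith)
  have h4 : Complex.Gamma (1 - s) ≠ 0 := Complex.Gamma_ne_zero_of_re_pos (by simpa using hs1)
  rw [zetaStrip, invGammaProd, regularMellin,
    (hasMellin_dilatedLog_add_singularPart ha0 d A B hs hs1 hsummable).2, add_comm 1 s,
    Complex.Gamma_add_one s hs0]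
  generalize Complex.Gamma s = x at *
  generalize Complex.Gamma (1 - s) = y at *
  generalize zetaSeries a s = ζ at *
  generalize hw : s - 1 / 2 = w at *
  field_simp
  ring

/-- Normal convergence on a vertical strip around s. The majorant adds the terms at both edges
because a_j² may lie on either side of 1. -/
theorem differentiableAt_zetaSeries {s : ℂ} (hs : 1 / 2 < s.re) (ha0 : ∀ j, a j ≠ 0)
    (hsummable : ∀ s : ℂ, 1 / 2 < s.re → Summable (zetaTerm a s)) :
    DifferentiableAt ℂ (zetaSeries a) s := by
  obtain ⟨σ, hσ, hσs⟩ := exists_between hs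
  have hb : ∀ j, 0 < a j ^ 2 := fun j => by have := ha0 j; positivity
  have hnorm : ∀ (w : ℂ) (j : ℕ), ‖zetaTerm a w j‖ = (a j ^ 2) ^ (-w.re) := fun w j => by
    rw [zetaTerm_eq, Complex.norm_cpow_eq_rpow_re_of_pos (hb j), Complex.neg_re]
  have hsumm : ∀ x : ℝ, 1 / 2 < x → Summable fun j => (a j ^ 2) ^ (-x) := fun x hx => by
    have := (hsummable (x : ℂ) (by simpa using hx)).norm
    simpa only [hnorm, Complex.ofReal_re] using this
  have hopen : IsOpen {w : ℂ | σ < w.re ∧ w.re < s.re + 1} :=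
    (isOpen_lt continuous_const Complex.continuous_re).inter
      (isOpen_lt Complex.continuous_re continuous_const)
  have h := Complex.differentiableOn_tsum_of_summable_norm (F := fun j w => zetaTerm a w j)
    ((hsumm σ hσ).add (hsumm (s.re + 1) (by linarith))) (fun j w _ => ?_) hopen
    (fun j w hw => ?_)
  · exact h.differentiableAt (hopen.mem_nhds ⟨hσs, lt_add_one _⟩)
  · have h0 : ((a j ^ 2 : ℝ) : ℂ) ≠ 0 := by exact_mod_cast (hb j).ne'
    simp only [zetaTerm_eq]
    exact (DifferentiableAt.const_cpow (by fun_prop) (Or.inl h0)).differentiableWithinAt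
  · rw [hnorm]
    rcases le_total 1 (a j ^ 2) with h1 | h1
    · have := Real.rpow_le_rpow_of_exponent_le h1 (neg_le_neg hw.1.le)
      have h2 : 0 < (a j ^ 2) ^ (-(s.re + 1)) := Real.rpow_pos_of_pos (hb j) _
      linarith
    · have := Real.rpow_le_rpow_of_exponent_ge (hb j) h1 (neg_le_neg hw.2.le)
      have h2 : 0 < (a j ^ 2) ^ (-σ) := Real.rpow_pos_of_pos (hb j) _
      linarith

theorem differentiableAt_zetaStrip {d A B : ℝ} {s : ℂ} (hs : s ≠ 1 / 2)
    (hm : DifferentiableAt ℂ (regularMellin a d A B) s) :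
    DifferentiableAt ℂ (zetaStrip a d A B) s := by
  have h1 : s - 1 / 2 ≠ 0 := sub_ne_zero.mpr hs
  have h2 := differentiable_invGammaProd s
  unfold zetaStrip
  fun_prop (disch := assumption)

theorem zetaStrip_zero (a : ℕ → ℝ) (d A B : ℝ) : zetaStrip a d A B 0 = -(A : ℂ) := by
  simp [zetaStrip, invGammaProd_zero]

/-- The s² terms vanish to second order and the prefactor is 1 + O(s²), so only -Bs contributes. -/
theorem hasDerivAt_zetaStrip_zero {d A B : ℝ}
    (hm : DifferentiableAt ℂ (regularMellin a d A B) 0) :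
    HasDerivAt (zetaStrip a d A B) (-(B : ℂ)) 0 := by
  have hsq : HasDerivAt (fun s : ℂ => s ^ 2) 0 0 := by
    simpa using hasDerivAt_pow 2 (0 : ℂ)
  have hq : HasDerivAt (fun s : ℂ => s - 1 / 2) 1 0 := (hasDerivAt_id 0).sub_const _
  have hN := ((((hsq.mul hm.hasDerivAt).sub ((hsq.const_mul (d : ℂ)).div hq (by norm_num))).sub
    (hasDerivAt_const (0 : ℂ) (A : ℂ))).sub ((hasDerivAt_id (0 : ℂ)).const_mul (B : ℂ)))
  refine (hasDerivAt_invGammaProd_zero.mul hN).congr_deriv ?_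
  simp [invGammaProd_zero]

/-- The continuation of the zeta series to the half-plane `Re s > -1/2`. -/
noncomputable def zetaContinuation (a : ℕ → ℝ) (d A B : ℝ) (s : ℂ) : ℂ :=
  open Classical in if 1 / 2 < s.re then zetaSeries a s else zetaStrip a d A B s

theorem zetaContinuation_eq_zetaStrip (ha0 : ∀ j, a j ≠ 0) (d A B : ℝ)
    (hsummable : ∀ s : ℂ, 1 / 2 < s.re → Summable (zetaTerm a s)) {s : ℂ} (hs1 : s.re < 1) :
    zetaContinuation a d A B s = zetaStrip a d A B s := by
  rw [zetaContinuation]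
  split_ifs with h
  · exact (zetaStrip_eq_zetaSeries ha0 d A B h hs1 (hsummable s h)).symm
  · rfl

theorem zetaContinuation_eventuallyEq (ha0 : ∀ j, a j ≠ 0) (d A B : ℝ)
    (hsummable : ∀ s : ℂ, 1 / 2 < s.re → Summable (zetaTerm a s)) {s : ℂ} (hs1 : s.re < 1) :
    zetaContinuation a d A B =ᶠ[𝓝 s] zetaStrip a d A B := by
  filter_upwards [(isOpen_lt Complex.continuous_re continuous_const).mem_nhds hs1] with w hw
  exact zetaContinuation_eq_zetaStrip ha0 d A B hsummable hw

theorem analyticOnNhd_zetaContinuation (ha : StrictMono a) (ha0 : ∀ j, a j ≠ 0)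
    (hsum : Summable fun j => 1 / (a j) ^ 2) {d A B b₁ b₂ : ℝ}
    (h : HasLogExpansion a 1 d A B b₁ b₂) :
    AnalyticOnNhd ℂ (zetaContinuation a d A B) ({s : ℂ | -(1 / 2) < s.re} \ {(1 / 2 : ℂ)}) := by
  have hsummable : ∀ s : ℂ, 1 / 2 < s.re → Summable (zetaTerm a s) :=
    fun s hs => h.summable_zetaTerm ha ha0 hsum hs
  refine DifferentiableOn.analyticOnNhd (fun s hs => ?_)
    ((isOpen_lt continuous_const Complex.continuous_re).sdiff isClosed_singleton)
  have hs1 : -(1 / 2) < s.re := hs.1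
  refine DifferentiableAt.differentiableWithinAt ?_
  by_cases hre : 1 / 2 < s.re
  · refine (differentiableAt_zetaSeries hre ha0 hsummable).congr_of_eventuallyEq ?_
    filter_upwards [(isOpen_lt continuous_const Complex.continuous_re).mem_nhds hre] with w hw
    exact if_pos hw
  · have hlt : s.re < 1 := by linarith [not_lt.mp hre]
    exact (differentiableAt_zetaStrip hs.2 (differentiableAt_regularMellin ha ha0 hsum h hs1
      hlt)).congr_of_eventuallyEq (zetaContinuation_eventuallyEq ha0 d A B hsummable hlt)

theorem meromorphicOrderAt_zetaContinuation (ha : StrictMono a) (ha0 : ∀ j, a j ≠ 0)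
    (hsum : Summable fun j => 1 / (a j) ^ 2) {d A B b₁ b₂ : ℝ} (hd : d ≠ 0)
    (h : HasLogExpansion a 1 d A B b₁ b₂) :
    meromorphicOrderAt (zetaContinuation a d A B) (1 / 2 : ℂ) = -1 := by
  have hsummable : ∀ s : ℂ, 1 / 2 < s.re → Summable (zetaTerm a s) :=
    fun s hs => h.summable_zetaTerm ha ha0 hsum hs
  -- g is (s - 1/2) times the continuation with the pole cancelled; its value at 1/2 is
  -- -`invGammaProd (1/2)` · d/4, nonzero because d ≠ 0.
  set g : ℂ → ℂ := fun s => invGammaProd s *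
    ((s - 1 / 2) * (s ^ 2 * regularMellin a d A B s - (A : ℂ) - (B : ℂ) * s) - (d : ℂ) * s ^ 2)
    with hg
  have hopen : IsOpen {s : ℂ | -(1 / 2) < s.re ∧ s.re < 1} :=
    (isOpen_lt continuous_const Complex.continuous_re).inter
      (isOpen_lt Complex.continuous_re continuous_const)
  have hmem : (1 / 2 : ℂ) ∈ {s : ℂ | -(1 / 2) < s.re ∧ s.re < 1} := by
    constructor <;> norm_num
  have hgd : DifferentiableOn ℂ g {s : ℂ | -(1 / 2) < s.re ∧ s.re < 1} := by
    intro s hs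
    have h1 := differentiableAt_regularMellin ha ha0 hsum h hs.1 hs.2
    have h2 := differentiable_invGammaProd s
    refine DifferentiableAt.differentiableWithinAt ?_
    rw [hg]
    fun_prop
  have hga : AnalyticAt ℂ g (1 / 2) := hgd.analyticAt (hopen.mem_nhds hmem)
  have hg0 : g (1 / 2) ≠ 0 := by
    have h1 : invGammaProd (1 / 2) ≠ 0 :=
      mul_ne_zero (inv_ne_zero (Complex.Gamma_ne_zero_of_re_pos (by norm_num)))
        (inv_ne_zero (Complex.Gamma_ne_zero_of_re_pos (by norm_num)))
    have h2 : (d : ℂ) ≠ 0 := by exact_mod_cast hd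
    rw [hg]
    simp only [sub_self, zero_mul, zero_sub]
    exact mul_ne_zero h1 (neg_ne_zero.mpr (mul_ne_zero h2 (by norm_num)))
  have heq : ∀ᶠ s in 𝓝[≠] (1 / 2 : ℂ),
      zetaContinuation a d A B s = (s - 1 / 2) ^ (-1 : ℤ) • g s := by
    filter_upwards [mem_nhdsWithin_of_mem_nhds (hopen.mem_nhds hmem), self_mem_nhdsWithin]
      with s hs hne
    have h1 : s - 1 / 2 ≠ 0 := sub_ne_zero.mpr hne
    rw [zetaContinuation_eq_zetaStrip ha0 d A B hsummable hs.2, zetaStrip, zpow_neg_one,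
      smul_eq_mul, hg]
    simp only
    generalize s - 1 / 2 = w at *
    field_simp
    ring
  have hmero : MeromorphicAt (zetaContinuation a d A B) (1 / 2) := by
    refine MeromorphicAt.congr (f := fun s => (s - 1 / 2) ^ (-1 : ℤ) • g s) ?_
      (heq.mono fun s hs => hs.symm)
    exact ((MeromorphicAt.id _).sub (MeromorphicAt.const _ _)).zpow _ |>.smul hga.meromorphicAt
  exact (meromorphicOrderAt_eq_int_iff hmero).mpr ⟨g, hga, hg0, heq⟩

end Continuation

end Auxiliary

theorem mainTheorem4 (a : ℕ → ℝ) (ha : StrictMono a) (ha0 : ∀ j, a j ≠ 0)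
    (hsum : Summable fun j => 1 / (a j) ^ 2) :
    -- the product converges to an entire function, of which `logProduct a` is a logarithm
    (∀ z : ℂ, Multipliable fun j => 1 - z ^ 2 / (a j : ℂ) ^ 2) ∧
    Differentiable ℂ (canonicalProduct a) ∧
    DifferentiableOn ℂ (logProduct a) (slitDomain a) ∧
    (∀ z ∈ slitDomain a, Complex.exp (logProduct a z) = canonicalProduct a z) ∧
    ∀ (κ : ℕ) (d A B b₁ b₂ : ℝ), HasLogExpansion a κ d A B b₁ b₂ →
      -- the integral representation
      (∀ s : ℂ, 1 / 2 < s.re → Summable (zetaTerm a s) ∧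
        ∀ c : ℝ, 0 < c → (∀ j, c < |a j|) →
          (∀ t : ℝ, 0 < t → WedgeIntegrable (innerIntegrand a t) c) ∧
          MeasureTheory.IntegrableOn (outerIntegrand a c s) (Set.Ioi 0) ∧
          zetaSeries a s =
            s ^ 2 / Complex.Gamma (s + 1) *
              ∫ t in Set.Ioi (0 : ℝ), outerIntegrand a c s t) ∧
      -- the pole, the continuation to a neighbourhood of `0`, and the values there
      ∃ (U : Set ℂ) (Z : ℂ → ℂ), IsOpen U ∧ IsConnected U ∧
        {s : ℂ | 1 / 2 < s.re} ⊆ U ∧ (1 / 2 : ℂ) ∈ U ∧ (0 : ℂ) ∈ U ∧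
        AnalyticOnNhd ℂ Z (U \ {(1 / 2 : ℂ)}) ∧
        (∀ s : ℂ, 1 / 2 < s.re → Z s = zetaSeries a s) ∧
        meromorphicOrderAt Z (1 / 2 : ℂ) = -1 ∧
        Z 0 = -(A : ℂ) ∧ deriv Z 0 = -(B : ℂ) := by
  refine ⟨multipliable_one_sub_sq_div hsum, differentiable_canonicalProduct hsum,
    fun z hz => (differentiableAt_logProduct ha0 hsum hz).differentiableWithinAt,
    fun z hz => exp_logProduct ha0 hsum hz, fun κ d A B b₁ b₂ h => ?_⟩
  obtain ⟨rfl, hd⟩ := h.eq_one_and_ne_zero ha0 hsum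
  have hsummable : ∀ s : ℂ, 1 / 2 < s.re → Summable (zetaTerm a s) :=
    fun s hs => h.summable_zetaTerm ha ha0 hsum hs
  refine ⟨fun s hs => ⟨hsummable s hs, fun c hc hca => ⟨fun t ht =>
    ⟨integrableOn_rayIntegrand_innerIntegrand ha0 hsum hc hca ht (Or.inl rfl),
      integrableOn_rayIntegrand_innerIntegrand ha0 hsum hc hca ht (Or.inr rfl)⟩,
    zeta_integral_representation ha0 hsum hc hca (by linarith) (hsummable s hs)⟩⟩, ?_⟩
  have h0 : (0 : ℂ).re < 1 := by simp
  refine ⟨{s : ℂ | -(1 / 2) < s.re}, zetaContinuation a d A B,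
    isOpen_lt continuous_const Complex.continuous_re,
    ((convex_halfSpace_re_gt (-(1 / 2))).isConnected ⟨0, ?_⟩), fun s hs => ?_, ?_, ?_,
    analyticOnNhd_zetaContinuation ha ha0 hsum h, fun s hs => if_pos hs,
    meromorphicOrderAt_zetaContinuation ha ha0 hsum hd h, ?_, ?_⟩
  · norm_num
  · have hs : 1 / 2 < s.re := hs
    change -(1 / 2) < s.re
    linarith
  · norm_num
  · norm_num
  · rw [zetaContinuation_eq_zetaStrip ha0 d A B hsummable h0, zetaStrip_zero]
  · rw [(zetaContinuation_eventuallyEq ha0 d A B hsummable h0).deriv_eq]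
    exact (hasDerivAt_zetaStrip_zero
      (differentiableAt_regularMellin ha ha0 hsum h (by norm_num) h0)).deriv
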